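/- Let $S=\mathbb C[x,y,z]$, let $f\in S$ be a homogeneous squarefree polynomial of degree $d\ge 3$, and let $C: f=0$ be the corresponding reduced curve in $\mathbb P^2_{\mathbb C}$. Let $$\bigoplus_{j=1}^{n} S(-c_j)\longrightarrow \bigoplus_{i=1}^{m} S(1-d-d_i)\longrightarrow S(1-d)^3\xrightarrow{(f_x,f_y,f_z)} S,\qquad c_1\le\dots\le c_n,\quad d_1\le\dots\le d_m,$$ be the minimal graded free resolution of the Jacobian algebra $M(f)=S/(f_x,f_y,f_z)$: the basis of $\bigoplus_i S(1-d-d_i)$ maps to a minimal system of homogeneous generators, of degrees $d_1,\dots,d_m$, of the module $\{(a,b,c)\in S^3 : af_x+bf_y+cf_z=0\}$, and the basis of $\bigoplus_j S(-c_j)$ maps to a minimal system of homogeneous generators of the kernel of the resulting map. The integers $d_1,\dots,d_m$ are the exponents of $C$. Suppose that the type $t=d_1+d_2+1-d$ of $C$ satisfies $t\ge 1$, and define $\epsilon_j$ by $c_j=d+d_{j+2}-1+\epsilon_j$. Then $m\ge 3$, $n=m-2$, the leftmost map is injective, the $\epsilon_j$ are integers $\ge 1$, and $t=\epsilon_1+\dots+\epsilon_n$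 (so $(\epsilon_1,\dots,\epsilon_n)$ is an ordered partition of $t$). Moreover $C$ has finitely many singular points $p$, at each of them the Tjurina algebra $\mathcal O_{\mathbb P^2,p}/(g,g_u,g_v)$ (where $g=0$ is the equation of $C$ in affine coordinates $u,v$ of a standard chart containing $p$) has finite dimension over $\mathbb C$, and the total Tjurina number $\tau(C)$, the sum of these dimensions over all singular points, is $$\tau(C)=d_1^2+d_1d_2+d_2^2-t(d_1+d_2)-\sum_{i=3}^m\epsilon_{i-2}d_i+R,$$ where $$R=\frac{t^2-\sum_{i=3}^m\epsilon_{i-2}^2}{2}=\sum_{3\le i<j\le m}\epsilon_{i-2}\epsilon_{j-2}\ge 0 .$$ In particular, $R=0$ if and only if $m=3$. -/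

import Mathlib

noncomputable section

namespace PlaneCurve

open MvPolynomial

/-- The graded polynomial ring `ℂ[x, y, z]`. -/
abbrev S : Type := MvPolynomial (Fin 3) ℂ

/-! ### Minimal graded free resolutions -/

/-- The vector `v` is homogeneous of degree `k` in the graded free module `⨁ i, S(-a i)`, whose
`i`-th basis vector has degree `a i`. -/
def IsHomogeneousVec {ι : Type} (a : ι → ℕ) (k : ℕ) (v : ι → S) : Prop :=
  ∀ i, ∀ μ ∈ (v i).support, a i + μ.degree = k

/-- `v 0, …, v (r - 1)` is a minimal system of homogeneous generators of the submodule `N` of the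
graded free module `⨁ i, S(-a i)`, listed by nondecreasing degrees `b 0 ≤ … ≤ b (r - 1)`.
(For homogeneous generators, irredundancy is the same as minimality of their number, and the same
as linear independence modulo `(x, y, z) N`.) -/
structure IsMinimalGenerators {ι : Type} (a : ι → ℕ) (N : Submodule S (ι → S))
    {r : ℕ} (b : Fin r → ℕ) (v : Fin r → ι → S) : Prop where
  monotone_degree : Monotone b
  homogeneous : ∀ j, IsHomogeneousVec a (b j) (v j)
  span_eq : Submodule.span S (Set.range v) = N
  irredundant : ∀ j, v j ∉ Submodule.span S (v '' {j}ᶜ)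

/-- The map `S³(1-d) → S`, `(u₀, u₁, u₂) ↦ u₀ f_x + u₁ f_y + u₂ f_z`. Its image is the Jacobian
ideal `J_f` and its cokernel is the Jacobian algebra `M(f) = S / J_f`. -/
def gradientMap (f : S) : (Fin 3 → S) →ₗ[S] S :=
  Fintype.linearCombination S (fun i => pderiv i f)

/-- A minimal graded free resolution of the Jacobian algebra `M(f)`, `f` of degree `d`:
`⨁ j, S(-c j) → ⨁ i, S(1-d-e i) → S³(1-d) → S`.
The second map sends the `i`-th basis vector to `syz i`, and the `syz i` are minimal homogeneous
generators of the kernel of `gradientMap f`; the first one sends the `j`-th basis vector to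
`syz₂ j`, and the `syz₂ j` are minimal homogeneous generators of the kernel of the second map.
Neither a relation between the ranks `m` and `n`, nor the injectivity of the first map, is
part of this definition. -/
structure MinimalResolution (f : S) (d m n : ℕ) where
  e : Fin m → ℕ
  c : Fin n → ℕ
  syz : Fin m → Fin 3 → S
  syz₂ : Fin n → Fin m → S
  minimal_syz : IsMinimalGenerators (fun _ => d - 1) (LinearMap.ker (gradientMap f))
    (fun i => d - 1 + e i) syz
  minimal_syz₂ : IsMinimalGenerators (fun i => d - 1 + e i)
    (LinearMap.ker (Fintype.linearCombination S syz)) c syz₂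

namespace MinimalResolution

variable {f : S} {d m n : ℕ} (F : MinimalResolution f d m n)

/-- The exponents `d_1 ≤ … ≤ d_m`, numbered from `1` (and `0` outside the range `1, …, m`). -/
def exponent (i : ℕ) : ℕ := if h : 1 ≤ i ∧ i ≤ m then F.e ⟨i - 1, by omega⟩ else 0

/-- The degrees `c_1 ≤ … ≤ c_n`, numbered from `1` (and `0` outside the range `1, …, n`). -/
def lastDegree (j : ℕ) : ℕ := if h : 1 ≤ j ∧ j ≤ n then F.c ⟨j - 1, by omega⟩ else 0

/-- The type `t = d_1 + d_2 + 1 - d`. -/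
def type : ℤ := F.exponent 1 + F.exponent 2 + 1 - d

/-- The integer `ε_j` defined by `c_j = d + d_{j+2} - 1 + ε_j`. -/
def eps (j : ℕ) : ℤ := F.lastDegree j - (d + F.exponent (j + 2) - 1)

end MinimalResolution

/-! ### The total Tjurina number -/

/-- The complex projective plane. -/
abbrev Plane : Type := Projectivization ℂ (Fin 3 → ℂ)

/-- The singular points of the curve `f = 0`. -/
def singularPoints (f : S) : Set Plane :=
  {p | eval p.rep f = 0 ∧ ∀ i, eval p.rep (pderiv i f) = 0}

theorem exists_coord_ne_zero (p : Plane) : ∃ i, p.rep i ≠ 0 :=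
  Function.ne_iff.mp p.rep_nonzero

/-- The index of a standard affine chart `x_i ≠ 0` of the plane that contains `p`. -/
def chart (p : Plane) : Fin 3 := (exists_coord_ne_zero p).choose

/-- The two coordinates of `p` in the affine chart `chart p`. -/
def affinePoint (p : Plane) : Fin 2 → ℂ :=
  fun k => p.rep ((chart p).succAbove k) / p.rep (chart p)

/-- The equation of the curve `f = 0` in the affine chart `x_i ≠ 0`: put `x_i = 1`. -/
def affineEquation (f : S) (i : Fin 3) : MvPolynomial (Fin 2) ℂ :=
  aeval (i.insertNth (1 : MvPolynomial (Fin 2) ℂ) X : Fin 3 → MvPolynomial (Fin 2) ℂ) f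

/-- The maximal ideal of the point `p` in the coordinate ring `ℂ[u, v]` of the chart `chart p`. -/
def pointIdeal (p : Plane) : Ideal (MvPolynomial (Fin 2) ℂ) :=
  RingHom.ker (eval (affinePoint p))

instance (p : Plane) : (pointIdeal p).IsPrime :=
  RingHom.ker_isPrime (eval (affinePoint p))

/-- The local ring of the plane at `p`, computed in the affine chart `chart p`. -/
abbrev LocalRingAt (p : Plane) : Type := Localization.AtPrime (pointIdeal p)

/-- The ideal `(g, g_u, g_v)` of the local ring at `p`, where `g = 0` is the local equation of the
curve `f = 0` in affine coordinates `u, v`. -/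
def tjurinaIdeal (f : S) (p : Plane) : Ideal (LocalRingAt p) :=
  (Ideal.span {affineEquation f (chart p), pderiv 0 (affineEquation f (chart p)),
    pderiv 1 (affineEquation f (chart p))}).map (algebraMap _ (LocalRingAt p))

/-- The local Tjurina algebra of the curve `f = 0` at `p`. -/
abbrev TjurinaAlgebra (f : S) (p : Plane) : Type := LocalRingAt p ⧸ tjurinaIdeal f p

/-- The local Tjurina number of the curve `f = 0` at `p`. -/
def localTjurina (f : S) (p : Plane) : ℕ := Module.finrank ℂ (TjurinaAlgebra f p)

/-- The total Tjurina number: the sum of the local ones over all singular points. -/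
def totalTjurina (f : S) : ℕ := ∑ᶠ p ∈ singularPoints f, localTjurina f p

end PlaneCurve

end

noncomputable section

namespace PlaneCurve

open MvPolynomial

/-! ### Graded free modules -/

section GradedFree

variable {ι κ : Type}

/-! The Hilbert function of the Jacobian algebra $M(f)$ is computed twice in large degrees, once
from the resolution and once from the singular points.

From the resolution: the leftmost map is injective (`ker_eq_bot_of_exact`, Hilbert's syzygy theorem,
proved by hand from the regular sequence $x,y,z$). Rank-nullity in each degree then gives $\dim
M(f)_k$ as a polynomial in $k$ of degree at most $2$ for $k\gg0$ (`jacobianHilbert_eq`). Since $f$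
is squarefree, two combinations of its partials are coprime, and the complete intersection they
define bounds $\dim M(f)_k$ by $(d-1)^2$. A bounded quadratic polynomial is constant. The vanishing
of the $k^2$ coefficient says $m=n+2$. The vanishing of the $k$ coefficient is a linear relation
between the degrees, equivalent to $\sum\epsilon_j=t$. The remaining constant is half a difference
of sums of squares of degrees, and substituting $c_j=d-1+d_{j+2}+\epsilon_j$ turns it into the
right-hand side of the formula (`numerical_relations`, `sum_sq_eq`).

From the singular points: forms of large degree map onto the product of the Tjurina algebras, after
division by powers of a linear form that vanishes at none of the points
(`sum_finrank_le_jacobianHilbert`). By the Nullstellensatz, a form of large degree that dies in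
every Tjurina algebra lies in the Jacobian ideal (`exists_forall_mem_jacobianIdeal`). Hence
$\tau(C)=\dim M(f)_k$ for $k\gg0$. The same surjectivity, combined with the bound $(d-1)^2$, gives
all the finiteness claims.

Positivity of the $\epsilon_j$ (`lt_c`) is a rank count. If $c_j$ were too small, the first $j$
relations would involve only the first $j+1$ syzygies. Together with the first two basis vectors,
whose images are independent, they would be $j+2$ independent vectors in $S^{j+1}$. The claims about
$R$ follow by expanding the square of $\sum\epsilon_j$. -/

/-- The degree `k` part of the graded free module `⨁ i, S(-a i)`. -/
def homogeneousVec (a : ι → ℕ) (k : ℕ) : Submodule ℂ (ι → S) where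
  carrier := {v | IsHomogeneousVec a k v}
  zero_mem' := by intro i μ hμ; simp at hμ
  add_mem' := by
    intro v w hv hw i μ hμ
    classical
    rcases Finset.mem_union.mp (support_add hμ) with h | h
    · exact hv i μ h
    · exact hw i μ h
  smul_mem' := by
    intro c v hv i μ hμ
    exact hv i μ (support_smul hμ)

theorem IsHomogeneousVec.isHomogeneous {a : ι → ℕ} {k : ℕ} {v : ι → S}
    (hv : IsHomogeneousVec a k v) (i : ι) : (v i).IsHomogeneous (k - a i) := by
  intro μ hμ
  have := hv i μ (mem_support_iff.mpr hμ)
  rw [Finsupp.degree_eq_weight_one] at this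
  change Finsupp.weight 1 μ = _
  simp only [Pi.one_def] at *
  omega

theorem IsHomogeneousVec.eq_zero_of_lt {a : ι → ℕ} {k : ℕ} {v : ι → S}
    (hv : IsHomogeneousVec a k v) {i : ι} (h : k < a i) : v i = 0 := by
  rw [← support_eq_empty, Finset.eq_empty_iff_forall_notMem]
  intro μ hμ
  have := hv i μ hμ
  omega

theorem isHomogeneousVec_of_le {a : ι → ℕ} {k : ℕ} {v : ι → S} (hak : ∀ i, a i ≤ k)
    (hv : ∀ i, (v i).IsHomogeneous (k - a i)) : IsHomogeneousVec a k v := by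
  intro i μ hμ
  have := hv i (mem_support_iff.mp hμ)
  have h2 := hak i
  rw [Finsupp.degree_eq_weight_one]
  simp only [Pi.one_def] at *
  omega

theorem homogeneousComponent_mul_of_isHomogeneous {p q : S} {e : ℕ} (hq : q.IsHomogeneous e)
    (n : ℕ) : homogeneousComponent n (p * q) =
      if e ≤ n then homogeneousComponent (n - e) p * q else 0 := by
  let : GradedAlgebra (homogeneousSubmodule (Fin 3) ℂ) := gradedAlgebra
  have h := DirectSum.coe_decompose_mul_of_right_mem (homogeneousSubmodule (Fin 3) ℂ) n
    (a := p) (b := q) (i := e) hq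
  have h2 : ∀ (r : S) (i : ℕ),
      (DirectSum.decompose (homogeneousSubmodule (Fin 3) ℂ) r i : S) = homogeneousComponent i r :=
    fun r i => decomposition.decompose'_apply r i
  rw [h2, h2] at h
  exact h

/-- The projection of `⨁ i, S(-a i)` to its part of degree `k`. -/
def vecComponent (a : ι → ℕ) (k : ℕ) (v : ι → S) : ι → S :=
  fun i => if a i ≤ k then homogeneousComponent (k - a i) (v i) else 0

theorem isHomogeneousVec_vecComponent (a : ι → ℕ) (k : ℕ) (v : ι → S) :
    IsHomogeneousVec a k (vecComponent a k v) := by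
  intro i μ hμ
  unfold vecComponent at hμ
  split_ifs at hμ with h
  · have := homogeneousComponent_isHomogeneous (k - a i) (v i) (mem_support_iff.mp hμ)
    rw [Finsupp.degree_eq_weight_one]
    simp only [Pi.one_def] at *
    omega
  · simp at hμ

theorem vecComponent_eq_self {a : ι → ℕ} {k : ℕ} {v : ι → S} (hv : IsHomogeneousVec a k v) :
    vecComponent a k v = v := by
  funext i
  unfold vecComponent
  split_ifs with h
  · exact homogeneousComponent_eq_self (hv.isHomogeneous i)
  · exact (hv.eq_zero_of_lt (by omega)).symm

theorem vecComponent_zero (a : ι → ℕ) (k : ℕ) : vecComponent a k 0 = 0 := by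
  funext i
  simp [vecComponent]

/-- A homogeneous matrix commutes with taking graded parts. This allows preimages and relations to
be replaced by homogeneous ones. -/
theorem vecComponent_linearCombination [Fintype κ] {a : ι → ℕ} {b : κ → ℕ} {w : κ → ι → S}
    (hw : ∀ j, IsHomogeneousVec a (b j) (w j)) (k : ℕ) (u : κ → S) :
    vecComponent a k (Fintype.linearCombination S w u) =
      Fintype.linearCombination S w (vecComponent b k u) := by
  funext i
  simp only [vecComponent, Fintype.linearCombination_apply, Finset.sum_apply, Pi.smul_apply,
    smul_eq_mul, map_sum]
  have key : ∀ j, (if a i ≤ k then homogeneousComponent (k - a i) (u j * w j i) else 0) =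
      (if b j ≤ k then homogeneousComponent (k - b j) (u j) else 0) * w j i := by
    intro j
    by_cases hab : a i ≤ b j
    · rw [homogeneousComponent_mul_of_isHomogeneous ((hw j).isHomogeneous i)]
      by_cases hb : b j ≤ k
      · rw [if_pos (by omega), if_pos (by omega), if_pos hb]
        congr 2
        congr 1
        omega
      · rw [if_neg hb, zero_mul]
        split_ifs
        · omega
        · rfl
        · rfl
    · simp [(hw j).eq_zero_of_lt (not_le.mp hab)]
  rw [← Finset.sum_congr rfl fun j _ => key j]
  split_ifs <;> simp

theorem linearCombination_mem_homogeneousVec [Fintype κ] {a : ι → ℕ} {b : κ → ℕ}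
    {w : κ → ι → S} (hw : ∀ j, IsHomogeneousVec a (b j) (w j)) {k : ℕ} {u : κ → S}
    (hu : IsHomogeneousVec b k u) :
    IsHomogeneousVec a k (Fintype.linearCombination S w u) := by
  rw [← vecComponent_eq_self hu, ← vecComponent_linearCombination hw]
  exact isHomogeneousVec_vecComponent a k _

theorem finrank_homogeneousSubmodule (k : ℕ) :
    Module.finrank ℂ (homogeneousSubmodule (Fin 3) ℂ k) = (k + 2).choose 2 := by
  have h : homogeneousSubmodule (Fin 3) ℂ k =
      restrictSupport ℂ (↑((Finset.univ : Finset (Fin 3)).finsuppAntidiag k) : Set (Fin 3 →₀ ℕ)) := by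
    rw [homogeneousSubmodule_eq_finsupp_supported]
    congr 1
    ext μ
    simp [Finset.mem_finsuppAntidiag, Finsupp.degree_eq_sum]
  rw [h, Module.finrank_eq_card_basis (basisRestrictSupport ℂ _)]
  simp only [Fintype.card_coe, Finset.card_finsuppAntidiag_nat_eq_choose, SetLike.coe_sort_coe,
    Finset.card_univ, Fintype.card_fin]
  rw [show 3 + k - 1 = k + 2 by omega, ← Nat.choose_symm_add]

instance (k : ℕ) : Module.Finite ℂ (homogeneousSubmodule (Fin 3) ℂ k) :=
  Module.Finite.iff_fg.mpr (homogeneousSubmodule_fg _ _ k)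

/-- The part of degree `k ≥ max a` of `⨁ i, S(-a i)` is a product of homogeneous parts of `S`. -/
def homogeneousVecEquiv {a : ι → ℕ} {k : ℕ} (hak : ∀ i, a i ≤ k) :
    homogeneousVec a k ≃ₗ[ℂ] ∀ i, homogeneousSubmodule (Fin 3) ℂ (k - a i) where
  toFun v i := ⟨v.1 i, v.2.isHomogeneous i⟩
  invFun v := ⟨fun i => (v i).1, isHomogeneousVec_of_le hak fun i => (v i).2⟩
  map_add' _ _ := rfl
  map_smul' _ _ := rfl
  left_inv _ := rfl
  right_inv _ := rfl

instance [Finite ι] (a : ι → ℕ) (k : ℕ) : Module.Finite ℂ (homogeneousVec a k) := by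
  let g : homogeneousVec a k →ₗ[ℂ] ∀ i, homogeneousSubmodule (Fin 3) ℂ (k - a i) :=
    { toFun := fun v i => ⟨v.1 i, v.2.isHomogeneous i⟩
      map_add' := fun _ _ => rfl
      map_smul' := fun _ _ => rfl }
  refine Module.Finite.of_injective g fun v w h => Subtype.ext (funext fun i => ?_)
  exact congrArg Subtype.val (congrFun h i)

theorem finrank_homogeneousVec [Fintype ι] {a : ι → ℕ} {k : ℕ} (hak : ∀ i, a i ≤ k) :
    Module.finrank ℂ (homogeneousVec a k) = ∑ i, (k - a i + 2).choose 2 := by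
  rw [(homogeneousVecEquiv hak).finrank_eq, Module.finrank_pi_fintype]
  simp only [finrank_homogeneousSubmodule]

/-- The part of degree `k` of a submodule of `⨁ i, S(-a i)`. -/
def degreePart (a : ι → ℕ) (k : ℕ) (N : Submodule S (ι → S)) : Submodule ℂ (ι → S) :=
  homogeneousVec a k ⊓ N.restrictScalars ℂ

instance [Finite ι] (a : ι → ℕ) (k : ℕ) (N : Submodule S (ι → S)) :
    Module.Finite ℂ (degreePart a k N) :=
  Submodule.finiteDimensional_of_le inf_le_left

theorem map_homogeneousVec [Fintype κ] {a : ι → ℕ} {b : κ → ℕ}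
    {w : κ → ι → S} (hw : ∀ j, IsHomogeneousVec a (b j) (w j)) (k : ℕ) :
    (homogeneousVec b k).map ((Fintype.linearCombination S w).restrictScalars ℂ) =
      degreePart a k (Submodule.span S (Set.range w)) := by
  ext v
  constructor
  · rintro ⟨u, hu, rfl⟩
    refine ⟨linearCombination_mem_homogeneousVec hw hu, ?_⟩
    change Fintype.linearCombination S w u ∈ Submodule.span S (Set.range w)
    rw [← Fintype.range_linearCombination]
    exact LinearMap.mem_range_self _ _
  · rintro ⟨hv, hvN⟩
    change v ∈ Submodule.span S (Set.range w) at hvN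
    rw [← Fintype.range_linearCombination] at hvN
    obtain ⟨u, rfl⟩ := hvN
    refine ⟨vecComponent b k u, isHomogeneousVec_vecComponent _ _ _, ?_⟩
    change Fintype.linearCombination S w (vecComponent b k u) = _
    rw [← vecComponent_linearCombination hw, vecComponent_eq_self hv]

/-- Rank-nullity in degree `k` for a homogeneous map of graded free modules. -/
theorem finrank_degreePart_span [Fintype κ] {a : ι → ℕ} {b : κ → ℕ}
    {w : κ → ι → S} (hw : ∀ j, IsHomogeneousVec a (b j) (w j)) (k : ℕ) :
    Module.finrank ℂ (degreePart a k (Submodule.span S (Set.range w))) +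
      Module.finrank ℂ (degreePart b k (LinearMap.ker (Fintype.linearCombination S w))) =
      Module.finrank ℂ (homogeneousVec b k) := by
  set T := ((Fintype.linearCombination S w).restrictScalars ℂ).domRestrict (homogeneousVec b k)
  have h := LinearMap.finrank_range_add_finrank_ker T
  have h1 : LinearMap.range T = degreePart a k (Submodule.span S (Set.range w)) := by
    rw [← map_homogeneousVec hw, LinearMap.range_domRestrict]
  have h2 : (LinearMap.ker T).map (homogeneousVec b k).subtype =
      degreePart b k (LinearMap.ker (Fintype.linearCombination S w)) := by
    rw [LinearMap.ker_domRestrict]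
    change Submodule.map _ (Submodule.comap _ _) = _
    rw [Submodule.map_comap_subtype]
    rfl
  rw [← h1, ← h2, Submodule.finrank_map_subtype_eq]
  exact h

end GradedFree

/-! ### Minimal generators and syzygies -/

section Syzygies

variable {ι κ : Type}

/-- A relation between minimal homogeneous generators has no constant terms. -/
theorem IsMinimalGenerators.coeff_zero_eq_zero {a : ι → ℕ} {N : Submodule S (ι → S)} {r : ℕ}
    {b : Fin r → ℕ} {v : Fin r → ι → S} (h : IsMinimalGenerators a N b v) {u : Fin r → S}
    (hu : Fintype.linearCombination S v u = 0) (j : Fin r) : coeff 0 (u j) = 0 := by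
  by_contra hc
  -- In degree `b j` the `j`-th coefficient of the relation is reduced to its constant term; if that
  -- is nonzero, `v j` can be solved for.
  set u' := vecComponent b (b j) u with hu'
  have h0 : Fintype.linearCombination S v u' = 0 := by
    rw [hu', ← vecComponent_linearCombination h.homogeneous, hu, vecComponent_zero]
  have hj : u' j = C (coeff 0 (u j)) := by
    simp [hu', vecComponent, homogeneousComponent_zero]
  rw [Fintype.linearCombination_apply, ← Finset.add_sum_erase _ _ (Finset.mem_univ j), hj] at h0
  refine h.irredundant j ?_
  have h1 : v j = (C (coeff 0 (u j))⁻¹ : S) • -∑ i ∈ Finset.univ.erase j, u' i • v i := by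
    rw [← eq_neg_of_add_eq_zero_left h0, smul_smul, ← C_mul, inv_mul_cancel₀ hc, C_1, one_smul]
  rw [h1]
  refine Submodule.smul_mem _ _ (Submodule.neg_mem _ (Submodule.sum_mem _ fun i hi => ?_))
  refine Submodule.smul_mem _ _ (Submodule.subset_span ⟨i, ?_, rfl⟩)
  simpa using (Finset.mem_erase.mp hi).1

theorem IsMinimalGenerators.mem {a : ι → ℕ} {N : Submodule S (ι → S)} {r : ℕ}
    {b : Fin r → ℕ} {v : Fin r → ι → S} (h : IsMinimalGenerators a N b v) (j : Fin r) :
    v j ∈ N := by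
  rw [← h.span_eq]
  exact Submodule.subset_span ⟨j, rfl⟩

/-- Two minimal generators of a kernel are linearly independent. -/
theorem IsMinimalGenerators.eq_zero_of_smul_add_smul {a : ι → ℕ} {G : (ι → S) →ₗ[S] S} {r : ℕ}
    {b : Fin r → ℕ} {v : Fin r → ι → S} (h : IsMinimalGenerators a (LinearMap.ker G) b v)
    {i j : Fin r} (hij : i ≠ j) {p q : S} (hpq : p • v i + q • v j = 0) : p = 0 ∧ q = 0 := by
  classical
  have hv : ∀ k, v k ≠ 0 := fun k hk => h.irredundant k (hk ▸ Submodule.zero_mem _)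
  by_contra hne
  have hp : p ≠ 0 := by
    rintro rfl
    rw [zero_smul, zero_add, smul_eq_zero_iff_left (hv j)] at hpq
    exact hne ⟨rfl, hpq⟩
  -- After removing common factors, the relation forces `v j = p' • w` and `v i = -(q' • w)`, where
  -- `w` is again in the kernel because the target is torsion-free.
  obtain ⟨p', q', c, hrel, rfl, rfl⟩ := UniqueFactorizationMonoid.exists_reduced_factors p hp q
  have hc : c ≠ 0 := left_ne_zero_of_mul hp
  have hp' : p' ≠ 0 := right_ne_zero_of_mul hp
  have hpq' : p' • v i + q' • v j = 0 := by
    rw [mul_smul, mul_smul, ← smul_add] at hpq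
    exact (smul_eq_zero_iff_right hc).mp hpq
  have hdvd : ∀ k, p' ∣ v j k := by
    intro k
    refine hrel.dvd_of_dvd_mul_left ⟨-v i k, ?_⟩
    have := congrFun hpq' k
    simp only [Pi.add_apply, Pi.smul_apply, smul_eq_mul, Pi.zero_apply] at this
    linear_combination this
  choose w hw using hdvd
  have hvj : v j = p' • w := funext hw
  have hvi : v i = -(q' • w) := by
    rw [hvj, smul_comm, ← smul_add] at hpq'
    exact eq_neg_of_add_eq_zero_left ((smul_eq_zero_iff_right hp').mp hpq')
  have hwN : w ∈ LinearMap.ker G := by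
    have := h.mem j
    rw [hvj, LinearMap.mem_ker, map_smul, smul_eq_zero_iff_right hp'] at this
    exact this
  rw [← h.span_eq, ← Fintype.range_linearCombination] at hwN
  obtain ⟨u, hu⟩ := hwN
  have hsingle : ∀ k, Fintype.linearCombination S v (Pi.single k 1) = v k := by
    intro k
    rw [Fintype.linearCombination_apply_single, one_smul]
  -- Writing `w` in the generators with coefficients `u` gives two relations, for `v i` and for `v
  -- j`. Their constant terms at `j` and `i` force `p'(0) ≠ 0` and then `u i (0) = 0`, so the
  -- constant term at `i` of the first relation reads `1 = 0`.
  have h1 := h.coeff_zero_eq_zero (u := Pi.single i 1 + q' • u)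
    (by rw [map_add, hsingle, map_smul, hu, hvi]; simp) i
  have h2 : ∀ k, _ := h.coeff_zero_eq_zero (u := Pi.single j 1 - p' • u)
    (by rw [map_sub, hsingle, map_smul, hu, hvj]; simp)
  have h3 := h2 i
  have h4 := h2 j
  have hmul : ∀ p q : S, coeff 0 (p * q) = coeff 0 p * coeff 0 q := map_mul constantCoeff
  simp only [Pi.add_apply, Pi.sub_apply, Pi.smul_apply, smul_eq_mul, Pi.single_eq_same,
    Pi.single_eq_of_ne hij, coeff_add, coeff_sub, hmul, coeff_zero] at h1 h3 h4
  have h5 : coeff 0 (1 : S) = 1 := by simp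
  rw [h5] at h1 h4
  have h6 : coeff 0 p' ≠ 0 := by
    intro h
    rw [h] at h4
    simp at h4
  have h7 : coeff 0 (u i) = 0 := by
    have : coeff 0 p' * coeff 0 (u i) = 0 := by linear_combination -h3
    exact (mul_eq_zero.mp this).resolve_left h6
  rw [h7] at h1
  simp at h1

/-- An ideal generated by variables is monomial, so membership is tested on supports, and
multiplying by another variable only shifts these. This is the regular-sequence property on which
the syzygy theorem below rests. -/
theorem mem_span_X_image_of_mul {s : Set (Fin 3)} {i : Fin 3} (hi : i ∉ s) {p : S}
    (h : X i * p ∈ Ideal.span (X '' s : Set S)) : p ∈ Ideal.span (X '' s : Set S) := by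
  rw [mem_ideal_span_X_image] at h ⊢
  intro μ hμ
  obtain ⟨k, hk, hne⟩ := h (Finsupp.single i 1 + μ) (by
    rw [mem_support_iff, coeff_X_mul]
    exact mem_support_iff.mp hμ)
  refine ⟨k, hk, ?_⟩
  have : i ≠ k := fun e => hi (e ▸ hk)
  simpa [Finsupp.single_apply, this] using hne

theorem exists_eq_X_smul {v w : ι → S} (h : (X 1 : S) • v + (X 2 : S) • w = 0) :
    ∃ c : ι → S, v = (X 2 : S) • c := by
  have key : ∀ i, ∃ c, v i = X 2 * c := by
    intro i
    have h1 : (X 1 : S) * v i ∈ Ideal.span (X '' {2} : Set S) := by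
      rw [Set.image_singleton, Ideal.mem_span_singleton]
      refine ⟨-w i, ?_⟩
      have := congrFun h i
      simp only [Pi.add_apply, Pi.smul_apply, smul_eq_mul, Pi.zero_apply] at this
      linear_combination this
    have h2 := mem_span_X_image_of_mul (by simp) h1
    rwa [Set.image_singleton, Ideal.mem_span_singleton] at h2
  choose c hc using key
  exact ⟨c, funext hc⟩

theorem exists_eq_X_smul_add_X_smul {u v w : ι → S}
    (h : (X 0 : S) • u + (X 1 : S) • v + (X 2 : S) • w = 0) :
    ∃ a b : ι → S, u = (X 1 : S) • a + (X 2 : S) • b := by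
  have key : ∀ i, ∃ a b, u i = X 1 * a + X 2 * b := by
    intro i
    have h1 : (X 0 : S) * u i ∈ Ideal.span (X '' {1, 2} : Set S) := by
      rw [Set.image_pair, Ideal.mem_span_pair]
      refine ⟨-v i, -w i, ?_⟩
      have := congrFun h i
      simp only [Pi.add_apply, Pi.smul_apply, smul_eq_mul, Pi.zero_apply] at this
      linear_combination -this
    have h2 := mem_span_X_image_of_mul (by simp) h1
    rw [Set.image_pair, Ideal.mem_span_pair] at h2
    obtain ⟨a, b, hab⟩ := h2
    exact ⟨a, b, by rw [← hab]; ring⟩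
  choose a b hab using key
  exact ⟨a, b, funext hab⟩

variable {ι₁ ι₂ ι₃ : Type}

/-- The quotient by $z$ stays in the kernel because the codomain has no torsion. -/
theorem ker_exists_eq_X_smul {M : Type} [AddCommGroup M] [Module S M] [Module.IsTorsionFree S M]
    {ψ : (ι₂ → S) →ₗ[S] M} {v w : ι₂ → S} (hv : ψ v = 0)
    (h : (X 1 : S) • v + (X 2 : S) • w = 0) : ∃ c, ψ c = 0 ∧ v = (X 2 : S) • c := by
  obtain ⟨c, rfl⟩ := exists_eq_X_smul h
  refine ⟨c, ?_, rfl⟩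
  rw [map_smul] at hv
  exact (smul_eq_zero_iff_right (X_ne_zero 2)).mp hv

/-- The coefficients `a`, `b` need not lie in the kernel. The failure `ψ a` is $z$ times an element
of `ker θ`, which exactness lifts to some `c`; the Koszul modification by `c` corrects both
coefficients without changing `u`. -/
theorem ker_exists_eq_X_smul_add_X_smul {θ : (ι₁ → S) →ₗ[S] S}
    {ψ : (ι₂ → S) →ₗ[S] (ι₁ → S)} (hψ : LinearMap.range ψ = LinearMap.ker θ) {u v w : ι₂ → S}
    (hu : ψ u = 0) (h : (X 0 : S) • u + (X 1 : S) • v + (X 2 : S) • w = 0) :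
    ∃ a b, ψ a = 0 ∧ ψ b = 0 ∧ u = (X 1 : S) • a + (X 2 : S) • b := by
  obtain ⟨a, b, rfl⟩ := exists_eq_X_smul_add_X_smul h
  rw [map_add, map_smul, map_smul] at hu
  have ha : θ (ψ a) = 0 := by
    have : ψ a ∈ LinearMap.ker θ := hψ ▸ LinearMap.mem_range_self ψ a
    exact this
  obtain ⟨c', hc', hac⟩ := ker_exists_eq_X_smul ha hu
  have hc'' : c' ∈ LinearMap.range ψ := hψ ▸ hc'
  obtain ⟨c, rfl⟩ := hc''
  refine ⟨a - (X 2 : S) • c, b + (X 1 : S) • c, ?_, ?_, ?_⟩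
  · rw [map_sub, map_smul, hac, sub_self]
  · rw [hac, smul_comm, ← smul_add] at hu
    rw [map_add, map_smul, add_comm]
    exact (smul_eq_zero_iff_right (X_ne_zero 2)).mp hu
  · rw [smul_sub, smul_add, smul_comm (X 1 : S) (X 2 : S) c]
    abel

/-- If `S^ι₃ → S^ι₂ → S^ι₁ → S` is exact, then `ker ∩ (x, y, z) S^ι₃ = (x, y, z) ker` for the kernel
of the first map. -/
theorem ker_exists_eq_sum_X_smul {θ : (ι₁ → S) →ₗ[S] S}
    {ψ : (ι₂ → S) →ₗ[S] (ι₁ → S)} {φ : (ι₃ → S) →ₗ[S] (ι₂ → S)}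
    (hψ : LinearMap.range ψ = LinearMap.ker θ) (hφ : LinearMap.range φ = LinearMap.ker ψ)
    {u v w : ι₃ → S} (h : φ ((X 0 : S) • u + (X 1 : S) • v + (X 2 : S) • w) = 0) :
    ∃ u' v' w', φ u' = 0 ∧ φ v' = 0 ∧ φ w' = 0 ∧
      (X 0 : S) • u + (X 1 : S) • v + (X 2 : S) • w =
        (X 0 : S) • u' + (X 1 : S) • v' + (X 2 : S) • w' := by
  have hmem : ∀ t, ψ (φ t) = 0 := by
    intro t
    have : φ t ∈ LinearMap.ker ψ := hφ ▸ LinearMap.mem_range_self φ t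
    exact this
  have hlift : ∀ t, ψ t = 0 → ∃ s, φ s = t := by
    intro t ht
    have : t ∈ LinearMap.range φ := hφ ▸ (LinearMap.mem_ker.mpr ht)
    exact this
  have h' := h
  simp only [map_add, map_smul] at h'
  obtain ⟨a, b, ha, hb, hu⟩ := ker_exists_eq_X_smul_add_X_smul hψ (hmem u) h'
  obtain ⟨a, rfl⟩ := hlift a ha
  obtain ⟨b, rfl⟩ := hlift b hb
  have h2 : (X 1 : S) • φ (v + (X 0 : S) • a) + (X 2 : S) • φ (w + (X 0 : S) • b) = 0 := by
    rw [hu] at h'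
    simp only [map_add, map_smul]
    rw [← h']
    module
  obtain ⟨c, hc, hvc⟩ := ker_exists_eq_X_smul (hmem _) h2
  obtain ⟨c, rfl⟩ := hlift c hc
  refine ⟨u - (X 1 : S) • a - (X 2 : S) • b, v + (X 0 : S) • a - (X 2 : S) • c,
    w + (X 0 : S) • b + (X 1 : S) • c, ?_, ?_, ?_, ?_⟩
  · rw [map_sub, map_sub, map_smul, map_smul, hu]
    abel
  · rw [map_sub, hvc, map_smul, sub_self]
  · rw [hvc, smul_comm, ← smul_add] at h2
    have := (smul_eq_zero_iff_right (X_ne_zero 2)).mp h2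
    rw [map_add, map_smul, add_comm]
    exact this
  · module

/-- Hilbert's syzygy theorem: the fourth map of a minimal free resolution over `ℂ[x, y, z]` is
zero. -/
theorem ker_eq_bot_of_exact {θ : (ι₁ → S) →ₗ[S] S}
    {ψ : (ι₂ → S) →ₗ[S] (ι₁ → S)} {φ : (ι₃ → S) →ₗ[S] (ι₂ → S)}
    (hψ : LinearMap.range ψ = LinearMap.ker θ) (hφ : LinearMap.range φ = LinearMap.ker ψ)
    (hmin : ∀ u, φ u = 0 → ∀ j, coeff 0 (u j) = 0) : LinearMap.ker φ = ⊥ := by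
  -- Minimality puts the kernel in $\mathfrak m S^{\iota_3}$. Since $\ker\varphi\cap\mathfrak m
  -- S^{\iota_3}=\mathfrak m\ker\varphi$, induction puts it in every $\mathfrak m^k S^{\iota_3}$,
  -- and these intersect in zero.
  have hI : ∀ k : ℕ, ∀ u, φ u = 0 → ∀ j, u j ∈ idealOfVars (Fin 3) ℂ ^ k := by
    intro k
    induction k with
    | zero => simp
    | succ k ih =>
      intro u hu
      have key : ∀ j, ∃ p q r, u j = X 0 * p + X 1 * q + X 2 * r := by
        intro j
        have : u j ∈ idealOfVars (Fin 3) ℂ ^ 1 := by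
          rw [mem_pow_idealOfVars_iff']
          intro μ hμ
          have : μ = 0 := by
            rw [← Finsupp.degree_eq_zero_iff]
            omega
          rw [this]
          exact hmin u hu j
        rw [pow_one, idealOfVars, Ideal.mem_span_range_iff_exists_fun] at this
        obtain ⟨c, hc⟩ := this
        refine ⟨c 0, c 1, c 2, ?_⟩
        rw [← hc, Fin.sum_univ_three]
        ring
      choose p q r hpqr using key
      have hu' : u = (X 0 : S) • p + (X 1 : S) • q + (X 2 : S) • r := funext hpqr
      obtain ⟨p', q', r', hp, hq, hr, e⟩ := ker_exists_eq_sum_X_smul hψ hφ (hu' ▸ hu)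
      intro j
      rw [hu', e]
      have hX : ∀ i : Fin 3, (X i : S) ∈ idealOfVars (Fin 3) ℂ :=
        fun i => Ideal.subset_span ⟨i, rfl⟩
      simp only [Pi.add_apply, Pi.smul_apply, smul_eq_mul, pow_succ']
      exact Ideal.add_mem _ (Ideal.add_mem _ (Ideal.mul_mem_mul (hX 0) (ih p' hp j))
        (Ideal.mul_mem_mul (hX 1) (ih q' hq j))) (Ideal.mul_mem_mul (hX 2) (ih r' hr j))
  rw [LinearMap.ker_eq_bot']
  intro u hu
  funext j
  ext μ
  exact (mem_pow_idealOfVars_iff' _ _).mp (hI (μ.degree + 1) u hu j) μ (Nat.lt_succ_self _)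

end Syzygies

/-! ### Injectivity of the leftmost map and the lower bound on the degrees of the relations. -/

namespace MinimalResolution

variable {f : S} {d m n : ℕ} (F : MinimalResolution f d m n)

theorem linearIndependent_syz₂ : LinearIndependent S F.syz₂ := by
  have h : LinearMap.ker (Fintype.linearCombination S F.syz₂) = ⊥ := by
    refine ker_eq_bot_of_exact (θ := gradientMap f) (ψ := Fintype.linearCombination S F.syz)
      ?_ ?_ ?_
    · rw [Fintype.range_linearCombination, F.minimal_syz.span_eq]
    · rw [Fintype.range_linearCombination, F.minimal_syz₂.span_eq]
    · exact fun u hu => F.minimal_syz₂.coeff_zero_eq_zero hu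
  rw [Fintype.linearIndependent_iff]
  intro g hg
  exact congrFun (LinearMap.ker_eq_bot'.mp h g hg)

/-- The relations of degree at most `d - 1 + e i` do not involve the `i`-th syzygy. -/
theorem syz₂_eq_zero {k : Fin n} {i : Fin m} (h : F.c k ≤ d - 1 + F.e i) : F.syz₂ k i = 0 := by
  have hh := F.minimal_syz₂.homogeneous k
  rcases h.lt_or_eq with h | h
  · exact hh.eq_zero_of_lt h
  · have h0 := hh.isHomogeneous i
    rw [h, Nat.sub_self] at h0
    rw [← homogeneousComponent_eq_self h0, homogeneousComponent_zero,
      F.minimal_syz.coeff_zero_eq_zero (F.minimal_syz₂.mem k) i, C_0]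

/-- Otherwise the first `j + 1` relations (counting from `0`) involve only the first `j + 2`
syzygies. They are independent, and stay so after adding the first two basis vectors, since the
first two syzygies are independent. That makes `j + 3` independent vectors in a free module of rank
`j + 2`. -/
theorem lt_c (j : Fin n) (hj : (j : ℕ) + 2 < m) : d - 1 + F.e ⟨j + 2, hj⟩ < F.c j := by
  by_contra! hle
  have hzero : ∀ k : Fin n, k ≤ j → ∀ i : Fin m, (j : ℕ) + 2 ≤ i → F.syz₂ k i = 0 := by
    intro k hk i hi
    refine F.syz₂_eq_zero ?_
    have h1 := F.minimal_syz₂.monotone_degree hk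
    have h2 : d - 1 + F.e ⟨j + 2, hj⟩ ≤ d - 1 + F.e i :=
      F.minimal_syz.monotone_degree (show (⟨j + 2, hj⟩ : Fin m) ≤ i from hi)
    omega
  let i₀ : Fin m := ⟨0, by omega⟩
  let i₁ : Fin m := ⟨1, by omega⟩
  have h01 : i₀ ≠ i₁ := by simp [i₀, i₁]
  let W : Set.Iic j ⊕ Bool → Fin m → S :=
    Sum.elim (fun k => F.syz₂ k) (fun b => Pi.single (if b then i₁ else i₀) 1)
  have hW : LinearIndependent S W := by
    rw [Fintype.linearIndependent_iff]
    intro g hg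
    rw [Fintype.sum_sum_type] at hg
    simp only [W, Sum.elim_inl, Sum.elim_inr, Fintype.sum_bool] at hg
    have hrel : ∀ k, Fintype.linearCombination S F.syz (F.syz₂ k) = 0 :=
      fun k => F.minimal_syz₂.mem k
    -- Mapping to the syzygies kills the relations and leaves a dependence between the first two
    -- syzygies.
    have h1 := congrArg (Fintype.linearCombination S F.syz) hg
    simp only [map_add, map_sum, map_smul, hrel, smul_zero, Finset.sum_const_zero, zero_add,
      Fintype.linearCombination_apply_single, one_smul, map_zero, if_true, Bool.false_eq_true,
      if_false] at h1
    obtain ⟨hg1, hg0⟩ := F.minimal_syz.eq_zero_of_smul_add_smul h01.symm h1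
    rw [hg1, hg0, zero_smul, zero_smul, add_zero, add_zero] at hg
    have h2 := Fintype.linearIndependent_iff.mp
      (F.linearIndependent_syz₂.comp (Subtype.val : Set.Iic j → Fin n) Subtype.val_injective)
      (fun k => g (Sum.inl k)) hg
    rintro (k | _ | _)
    exacts [h2 k, hg0, hg1]
  let res : (Fin m → S) →ₗ[S] (Fin (j + 2) → S) :=
    LinearMap.funLeft S S (Fin.castLE (by omega))
  have hWres : ∀ v ∈ Submodule.span S (Set.range W), ∀ i : Fin m, (j : ℕ) + 2 ≤ i → v i = 0 := by
    intro v hv i hi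
    have : Submodule.span S (Set.range W) ≤ LinearMap.ker (LinearMap.proj i) := by
      rw [Submodule.span_le]
      rintro _ ⟨k | b, rfl⟩
      · exact hzero k k.2 i hi
      · have : i ≠ if b then i₁ else i₀ := by
          intro e
          have := congrArg Fin.val e
          cases b <;> simp [i₀, i₁] at this <;> omega
        simp [W, this]
    exact this hv
  have hdisj : Disjoint (Submodule.span S (Set.range W)) (LinearMap.ker res) := by
    rw [Submodule.disjoint_def]
    intro v hv hres
    funext i
    by_cases hi : (i : ℕ) < j + 2
    · exact congrFun (LinearMap.mem_ker.mp hres) ⟨i, hi⟩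
    · exact hWres v hv i (not_lt.mp hi)
  have hcard := (hW.map hdisj).fintype_card_le_finrank
  have hIic : Fintype.card (Set.Iic j) = j + 1 := by
    rw [← Set.toFinset_card, Set.toFinset_Iic, Fin.card_Iic]
  rw [Module.finrank_fin_fun, Fintype.card_sum, Fintype.card_bool, hIic] at hcard
  omega

end MinimalResolution

/-! ### The Hilbert function of the Jacobian algebra of a reduced curve is bounded -/

theorem totalDegree_pderiv_lt {i : Fin 3} {h : S} (hi : pderiv i h ≠ 0) :
    (pderiv i h).totalDegree < h.totalDegree := by
  obtain ⟨μ, hμ, e⟩ := Finset.exists_mem_eq_sup _ (support_nonempty.mpr hi)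
    (fun s : Fin 3 →₀ ℕ => s.sum fun _ e => e)
  change (pderiv i h).totalDegree = _ at e
  rw [e]
  have h1 : μ + Finsupp.single i 1 ∈ h.support := by
    rw [mem_support_iff, coeff_pderiv] at hμ
    exact mem_support_iff.mpr (left_ne_zero_of_mul hμ)
  have h2 := le_totalDegree h1
  rw [Finsupp.sum_add_index' (fun _ => rfl) (fun _ _ _ => rfl), Finsupp.sum_single_index rfl] at h2
  omega

theorem pderiv_eq_zero_of_dvd {i : Fin 3} {h : S} (hd : h ∣ pderiv i h) : pderiv i h = 0 := by
  by_contra hne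
  have h1 := totalDegree_pderiv_lt hne
  obtain ⟨q, hq⟩ := hd
  have hh : h ≠ 0 := by
    rintro rfl
    simp at hne
  have hq0 : q ≠ 0 := by
    rintro rfl
    exact hne (by rw [hq, mul_zero])
  rw [hq, totalDegree_mul_of_isDomain hh hq0] at h1
  omega

theorem eq_C_of_pderiv_eq_zero {h : S} (hh : ∀ i, pderiv i h = 0) : h = C (coeff 0 h) := by
  ext μ
  rw [coeff_C]
  split_ifs with h0
  · rw [h0]
  · obtain ⟨i, hi⟩ := Finsupp.ne_iff.mp (Ne.symm h0)
    have h1 : μ - Finsupp.single i 1 + Finsupp.single i 1 = μ := by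
      ext j
      by_cases hj : i = j
      · subst hj
        have : μ i ≠ 0 := hi
        simp
        omega
      · simp [hj]
    have h2 := congrArg (coeff (μ - Finsupp.single i 1)) (hh i)
    rw [coeff_pderiv, h1, coeff_zero] at h2
    exact (mul_eq_zero.mp h2).resolve_right (Nat.cast_add_one_ne_zero _)

/-- The partial derivatives of a squarefree homogeneous polynomial have no common factor. -/
theorem exists_not_dvd_pderiv {f : S} {d : ℕ} (hd : d ≠ 0) (hf : f.IsHomogeneous d)
    (hred : Squarefree f) {h : S} (hh : Irreducible h) : ∃ i, ¬ h ∣ pderiv i f := by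
  by_contra! hdvd
  have hp : Prime h := hh.prime
  -- Euler's identity.
  have h1 : h ∣ f := by
    have h2 : h ∣ (d : S) * f := by
      rw [← nsmul_eq_mul, ← hf.sum_X_mul_pderiv]
      exact Finset.dvd_sum fun i _ => (hdvd i).mul_left _
    have h3 : (d : S) * C ((d : ℂ)⁻¹) = 1 := by
      rw [← C_eq_coe_nat, ← C_mul, mul_inv_cancel₀ (by exact_mod_cast hd), C_1]
    have h4 : f = ((d : S) * f) * C ((d : ℂ)⁻¹) := by linear_combination -f * h3
    rw [h4]
    exact h2.mul_right _
  obtain ⟨g, rfl⟩ := h1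
  -- With `f = h * g`, the product rule leaves `h ∣ pderiv i h * g`, and `h ∣ g` is excluded by
  -- squarefreeness. For degree reasons all partials of `h` then vanish, so `h` is constant.
  have h5 : ∀ i, h ∣ pderiv i h := by
    intro i
    have h6 : h ∣ pderiv i h * g := by
      have := hdvd i
      rw [pderiv_mul] at this
      exact (dvd_add_left (dvd_mul_right h _)).mp this
    rcases hp.dvd_or_dvd h6 with h7 | h7
    · exact h7
    · exact absurd (hred h (mul_dvd_mul_left h h7)) hh.not_isUnit
  have h8 := eq_C_of_pderiv_eq_zero fun i => pderiv_eq_zero_of_dvd (h5 i)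
  have h9 : coeff 0 h ≠ 0 := by
    intro h0
    rw [h0, C_0] at h8
    exact hh.ne_zero h8
  refine hh.not_isUnit ?_
  rw [h8]
  exact (isUnit_iff_ne_zero.mpr h9).map C

/-- Two general linear combinations of the partial derivatives of a squarefree homogeneous
polynomial are coprime. -/
theorem exists_isRelPrime_sum_pderiv {f : S} {d : ℕ} (hd : d ≠ 0) (hf : f.IsHomogeneous d)
    (hred : Squarefree f) : ∃ (i : Fin 3) (c : Fin 3 → ℂ),
      pderiv i f ≠ 0 ∧ IsRelPrime (pderiv i f) (∑ j, c j • pderiv j f) := by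
  classical
  obtain ⟨i, hi⟩ := exists_not_dvd_pderiv hd hf hred (X_prime (i := (0 : Fin 3))).irreducible
  have ha : pderiv i f ≠ 0 := fun h0 => hi (h0 ▸ dvd_zero _)
  let L : (Fin 3 → ℂ) →ₗ[ℂ] S := Fintype.linearCombination ℂ (fun j => pderiv j f)
  let V : S → Subspace ℂ (Fin 3 → ℂ) :=
    fun h => ((Ideal.span {h}).restrictScalars ℂ).comap L
  let s := (UniqueFactorizationMonoid.factors (pderiv i f)).toFinset.image V
  -- Each irreducible factor of the chosen partial excludes a proper subspace of coefficient
  -- vectors; finitely many of these do not cover $\mathbb C^3$.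
  have hs : ⊤ ∉ s := by
    intro htop
    obtain ⟨h, hh, hV⟩ := Finset.mem_image.mp htop
    have hirr := UniqueFactorizationMonoid.irreducible_of_factor h (Multiset.mem_toFinset.mp hh)
    obtain ⟨j, hj⟩ := exists_not_dvd_pderiv hd hf hred hirr
    have : Pi.single j 1 ∈ V h := hV ▸ Submodule.mem_top
    have : L (Pi.single j 1) ∈ Ideal.span {h} := this
    rw [Ideal.mem_span_singleton, Fintype.linearCombination_apply_single, one_smul] at this
    exact hj this
  obtain ⟨c, hc⟩ := (Set.ne_univ_iff_exists_notMem _).mp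
    (Subspace.biUnion_ne_univ_of_top_notMem hs)
  refine ⟨i, c, ha, ?_⟩
  rw [UniqueFactorizationMonoid.isRelPrime_iff_no_prime_factors ha]
  intro h h1 h2 hp
  obtain ⟨h', hh', hassoc⟩ :=
    UniqueFactorizationMonoid.exists_mem_factors_of_dvd ha hp.irreducible h1
  refine hc (Set.mem_biUnion (Finset.mem_coe.mpr (Finset.mem_image_of_mem V
    (Multiset.mem_toFinset.mpr hh'))) ?_)
  change L c ∈ Ideal.span {h'}
  rw [Ideal.mem_span_singleton, Fintype.linearCombination_apply]
  exact hassoc.symm.dvd.trans h2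

/-- The partial derivatives, as vectors with one entry. -/
def gradient (f : S) : Fin 3 → Unit → S := fun i _ => pderiv i f

/-- The Jacobian ideal, as a submodule of `S¹`. -/
abbrev jacobian (f : S) : Submodule S (Unit → S) := Submodule.span S (Set.range (gradient f))

theorem isHomogeneousVec_unit {p : S} {k : ℕ} (hp : p.IsHomogeneous k) :
    IsHomogeneousVec (fun _ : Unit => 0) k (fun _ => p) :=
  isHomogeneousVec_of_le (fun _ => Nat.zero_le _) fun _ => hp

theorem isHomogeneousVec_gradient {f : S} {d : ℕ} (hf : f.IsHomogeneous d) (i : Fin 3) :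
    IsHomogeneousVec (fun _ : Unit => 0) (d - 1) (gradient f i) :=
  isHomogeneousVec_unit hf.pderiv

/-- The Koszul relation generates the relations between two coprime polynomials. -/
theorem ker_eq_span_of_isRelPrime {p q : S} (hp : p ≠ 0) (hpq : IsRelPrime p q) :
    LinearMap.ker (Fintype.linearCombination S ![fun _ : Unit => p, fun _ => q]) =
      Submodule.span S (Set.range fun _ : Unit => ![q, -p]) := by
  rw [Set.range_const]
  ext u
  rw [Submodule.mem_span_singleton, LinearMap.mem_ker, Fintype.linearCombination_apply,
    Fin.sum_univ_two]
  constructor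
  · intro h
    have h1 : u 0 * p + u 1 * q = 0 := congrFun h ()
    obtain ⟨w, hw⟩ : p ∣ u 1 := hpq.dvd_of_dvd_mul_right ⟨-u 0, by linear_combination h1⟩
    have h2 : u 0 = -w * q := by
      rw [hw] at h1
      exact mul_left_cancel₀ hp (by linear_combination h1)
    refine ⟨-w, ?_⟩
    funext i
    fin_cases i
    · simp [h2]
    · simp [hw, mul_comm]
  · rintro ⟨w, rfl⟩
    funext i
    simp
    ring

/-- The Jacobian ideal contains a complete intersection $(p,q)$ of two forms of degree $d-1$, whose
Koszul resolution gives its Hilbert function. The correction term stands on the right to avoid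
truncated subtraction. -/
theorem le_finrank_degreePart_jacobian {f : S} {d : ℕ} (hd : d ≠ 0) (hf : f.IsHomogeneous d)
    (hred : Squarefree f) {k : ℕ} (hk : 2 * (d - 1) ≤ k) :
    2 * (k - (d - 1) + 2).choose 2 ≤
      Module.finrank ℂ (degreePart (fun _ => 0) k (jacobian f)) +
        (k - 2 * (d - 1) + 2).choose 2 := by
  obtain ⟨i, c, hne, hrel⟩ := exists_isRelPrime_sum_pderiv hd hf hred
  set p := pderiv i f with hp
  set q := ∑ j, c j • pderiv j f with hq
  have hpD : p.IsHomogeneous (d - 1) := hf.pderiv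
  have hqD : q.IsHomogeneous (d - 1) :=
    Submodule.sum_mem (homogeneousSubmodule (Fin 3) ℂ (d - 1)) fun j _ =>
      Submodule.smul_mem _ _ hf.pderiv
  have h1 := finrank_degreePart_span (a := fun _ : Unit => 0) (b := fun _ : Fin 2 => d - 1)
    (w := ![fun _ : Unit => p, fun _ => q])
    (fun j => by fin_cases j <;> exact isHomogeneousVec_unit (by assumption)) k
  rw [ker_eq_span_of_isRelPrime hne hrel, finrank_homogeneousVec (fun _ => by omega)] at h1
  have h2 := finrank_degreePart_span (a := fun _ : Fin 2 => d - 1)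
    (b := fun _ : Unit => 2 * (d - 1)) (w := fun _ : Unit => ![q, -p])
    (fun _ => isHomogeneousVec_of_le (fun _ => by omega) fun j => by
      rw [show 2 * (d - 1) - (d - 1) = d - 1 by omega]
      fin_cases j
      · exact hqD
      · exact hpD.neg) k
  rw [finrank_homogeneousVec (fun _ => hk)] at h2
  simp only [Finset.sum_const, Finset.card_univ, Fintype.card_fin, Fintype.card_unit,
    smul_eq_mul, one_mul] at h1 h2
  have hle : Submodule.span S (Set.range ![fun _ : Unit => p, fun _ => q]) ≤ jacobian f := by
    rw [Submodule.span_le]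
    rintro _ ⟨j, rfl⟩
    have hg : ∀ j, gradient f j ∈ jacobian f := fun j => Submodule.subset_span ⟨j, rfl⟩
    fin_cases j
    · exact hg i
    · change (fun _ : Unit => q) ∈ jacobian f
      have : (fun _ : Unit => q) = ∑ j, (C (c j) : S) • gradient f j := by
        funext x
        simp [hq, gradient, smul_eq_C_mul]
      rw [this]
      exact Submodule.sum_mem _ fun j _ => Submodule.smul_mem _ _ (hg j)
  have h3 : Module.finrank ℂ (degreePart (fun _ => 0) k
      (Submodule.span S (Set.range ![fun _ : Unit => p, fun _ => q]))) ≤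
      Module.finrank ℂ (degreePart (fun _ => 0) k (jacobian f)) :=
    Submodule.finrank_mono (inf_le_inf_left _ hle)
  omega

theorem cast_choose_two (N : ℕ) : ((N + 2).choose 2 : ℚ) = (N + 2) * (N + 1) / 2 := by
  rw [Nat.cast_choose_two]
  push_cast
  ring

theorem choose_le_finrank_degreePart_jacobian {f : S} {d : ℕ} (hd : d ≠ 0)
    (hf : f.IsHomogeneous d) (hred : Squarefree f) {k : ℕ} (hk : 2 * (d - 1) ≤ k) :
    (k + 2).choose 2 ≤
      Module.finrank ℂ (degreePart (fun _ => 0) k (jacobian f)) + (d - 1) ^ 2 := by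
  have h := le_finrank_degreePart_jacobian hd hf hred hk
  obtain ⟨l, rfl⟩ := Nat.exists_eq_add_of_le hk
  rw [show 2 * (d - 1) + l - (d - 1) = (d - 1) + l by omega, Nat.add_sub_cancel_left] at h
  generalize Module.finrank ℂ (degreePart (fun _ : Unit => 0) (2 * (d - 1) + l) (jacobian f)) = r
    at h ⊢
  generalize d - 1 = D at h ⊢
  have h' : (2 * ((D + l + 2).choose 2 : ℕ) : ℚ) ≤ r + ((l + 2).choose 2 : ℕ) := by exact_mod_cast h
  have : (((2 * D + l + 2).choose 2 : ℕ) : ℚ) ≤ r + (D : ℚ) ^ 2 := by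
    rw [cast_choose_two] at h' ⊢
    rw [cast_choose_two] at h'
    push_cast at h' ⊢
    linarith
  exact_mod_cast this

/-! ### The Hilbert polynomial of the Jacobian algebra -/

/-- Finite differences: with $g$ the quadratic, $g(N)-2g(2N)+g(3N)=2\alpha N^2$, and once
$\alpha=0$, $g(2N)-g(N)=\beta N$. Both stay bounded as $N$ grows. -/
theorem eq_zero_of_quadratic_bounded {α β γ B : ℚ} {K : ℕ}
    (h : ∀ k : ℕ, K ≤ k → 0 ≤ α * (k : ℚ) ^ 2 + β * k + γ ∧ α * (k : ℚ) ^ 2 + β * k + γ ≤ B) :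
    α = 0 ∧ β = 0 := by
  have hlin : ∀ {x c : ℚ}, (∀ N : ℕ, K + 1 ≤ N → |x| * N ≤ c) → x = 0 := by
    intro x c hx
    by_contra hne
    obtain ⟨N, hN⟩ := exists_nat_gt (c / |x|)
    have hpos : 0 < |x| := abs_pos.mpr hne
    have h1 := hx (N + K + 1) (by omega)
    rw [div_lt_iff₀ hpos] at hN
    push_cast at h1
    have : 0 ≤ |x| * (K + 1 : ℚ) := by positivity
    linarith
  have hα : α = 0 := by
    refine hlin (c := B) fun N hN => ?_
    have h1 := h N (by omega)
    have h2 := h (2 * N) (by omega)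
    have h3 := h (3 * N) (by omega)
    push_cast at h2 h3
    have hN1 : (1 : ℚ) ≤ N := by exact_mod_cast (by omega : 1 ≤ N)
    have h4 : |α| * (N : ℚ) ^ 2 ≤ B := by
      rw [← abs_of_nonneg (sq_nonneg (N : ℚ)), ← abs_mul, abs_le]
      constructor <;> linarith
    have h5 : |α| * N ≤ |α| * (N : ℚ) ^ 2 :=
      mul_le_mul_of_nonneg_left (by nlinarith) (abs_nonneg α)
    linarith
  refine ⟨hα, hlin (c := B) fun N hN => ?_⟩
  have h1 := h N (by omega)
  have h2 := h (2 * N) (by omega)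
  rw [hα] at h1 h2
  push_cast at h2
  rw [← Nat.abs_cast N, ← abs_mul, abs_le]
  constructor <;> linarith

theorem cast_choose_two_sub {a k : ℕ} (h : a ≤ k) :
    ((k - a + 2).choose 2 : ℚ) =
      ((k : ℚ) ^ 2 + 3 * k + 2) / 2 - (2 * k + 3) / 2 * a + (a : ℚ) ^ 2 / 2 := by
  rw [cast_choose_two, Nat.cast_sub h]
  ring

theorem sum_cast_choose_two_sub {ι : Type} [Fintype ι] {a : ι → ℕ} {k : ℕ} (h : ∀ i, a i ≤ k) :
    ((∑ i, (k - a i + 2).choose 2 : ℕ) : ℚ) =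
      Fintype.card ι * (((k : ℚ) ^ 2 + 3 * k + 2) / 2) - (2 * k + 3) / 2 * ∑ i, (a i : ℚ) +
        (∑ i, (a i : ℚ) ^ 2) / 2 := by
  rw [Nat.cast_sum, Finset.sum_congr rfl fun i _ => cast_choose_two_sub (h i),
    Finset.sum_add_distrib, Finset.sum_sub_distrib, Finset.sum_const, ← Finset.mul_sum,
    Finset.sum_div, Finset.card_univ, nsmul_eq_mul]

theorem ker_linearCombination_gradient (f : S) :
    LinearMap.ker (Fintype.linearCombination S (gradient f)) =
      LinearMap.ker (gradientMap f) := by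
  ext u
  simp only [LinearMap.mem_ker, gradientMap, Fintype.linearCombination_apply]
  constructor
  · intro h
    have := congrFun h ()
    simpa [gradient] using this
  · intro h
    funext x
    simpa [gradient] using h

/-- The dimension of the part of degree `k` of the Jacobian algebra. -/
def jacobianHilbert (f : S) (k : ℕ) : ℚ :=
  ((k + 2).choose 2 : ℚ) - Module.finrank ℂ (degreePart (fun _ => 0) k (jacobian f))

namespace MinimalResolution

variable {f : S} {d m n : ℕ} (F : MinimalResolution f d m n)

theorem jacobianHilbert_eq (hf : f.IsHomogeneous d) : ∃ K : ℕ, ∀ k, K ≤ k →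
    jacobianHilbert f k = ((m : ℚ) - n - 2) * (((k : ℚ) ^ 2 + 3 * k + 2) / 2) -
      (2 * k + 3) / 2 * (∑ i, ((d - 1 + F.e i : ℕ) : ℚ) - ∑ j, (F.c j : ℚ) - 3 * (d - 1 : ℕ)) +
      (∑ i, ((d - 1 + F.e i : ℕ) : ℚ) ^ 2 - ∑ j, (F.c j : ℚ) ^ 2 - 3 * (d - 1 : ℕ) ^ 2) / 2 := by
  -- Beyond this threshold `k` is at least every degree shift, so no subtraction in the binomials
  -- truncates.
  refine ⟨(d - 1) + ∑ i, (d - 1 + F.e i) + ∑ j, F.c j, fun k hk => ?_⟩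
  have he : ∀ i, d - 1 + F.e i ≤ k := fun i =>
    (Finset.single_le_sum (f := fun i => d - 1 + F.e i) (fun _ _ => Nat.zero_le _)
      (Finset.mem_univ i)).trans (by omega)
  have hc : ∀ j, F.c j ≤ k := fun j =>
    (Finset.single_le_sum (f := F.c) (fun _ _ => Nat.zero_le _)
      (Finset.mem_univ j)).trans (by omega)
  have h1 := finrank_degreePart_span (a := fun _ : Unit => 0) (b := fun _ : Fin 3 => d - 1)
    (isHomogeneousVec_gradient hf) k
  have h2 := finrank_degreePart_span F.minimal_syz.homogeneous k
  have h3 := finrank_degreePart_span F.minimal_syz₂.homogeneous k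
  have h4 : LinearMap.ker (Fintype.linearCombination S F.syz₂) = ⊥ := by
    rw [LinearMap.ker_eq_bot']
    intro u hu
    funext i
    exact Fintype.linearIndependent_iff.mp F.linearIndependent_syz₂ u hu i
  have h5 : Module.finrank ℂ (degreePart F.c k (⊥ : Submodule S (Fin n → S))) = 0 := by
    have : degreePart F.c k (⊥ : Submodule S (Fin n → S)) = ⊥ := by
      rw [degreePart, Submodule.restrictScalars_bot, inf_bot_eq]
    rw [this, finrank_bot]
  rw [ker_linearCombination_gradient, finrank_homogeneousVec (fun _ => by omega)] at h1
  rw [F.minimal_syz.span_eq, finrank_homogeneousVec he] at h2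
  rw [F.minimal_syz₂.span_eq, h4, h5, add_zero, finrank_homogeneousVec hc] at h3
  have h1' := congrArg (Nat.cast : ℕ → ℚ) h1
  have h2' := congrArg (Nat.cast : ℕ → ℚ) h2
  have h3' := congrArg (Nat.cast : ℕ → ℚ) h3
  rw [sum_cast_choose_two_sub (fun _ => by omega)] at h1'
  rw [sum_cast_choose_two_sub he] at h2'
  rw [sum_cast_choose_two_sub hc] at h3'
  simp only [Fintype.card_fin, Finset.sum_const, Finset.card_univ, nsmul_eq_mul,
    Nat.cast_add] at h1' h2' h3'
  rw [jacobianHilbert, cast_choose_two]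
  push_cast at h1' h2' h3' ⊢
  linarith

theorem numerical_relations (hd : d ≠ 0) (hf : f.IsHomogeneous d) (hred : Squarefree f) :
    m = n + 2 ∧ ∑ i, ((d - 1 + F.e i : ℕ) : ℚ) = ∑ j, (F.c j : ℚ) + 3 * (d - 1 : ℕ) ∧
    ∃ K : ℕ, ∀ k, K ≤ k → jacobianHilbert f k =
      (∑ i, ((d - 1 + F.e i : ℕ) : ℚ) ^ 2 - ∑ j, (F.c j : ℚ) ^ 2 - 3 * (d - 1 : ℕ) ^ 2) / 2 := by
  obtain ⟨K, hK⟩ := F.jacobianHilbert_eq hf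
  set s := ∑ i, ((d - 1 + F.e i : ℕ) : ℚ) - ∑ j, (F.c j : ℚ) - 3 * (d - 1 : ℕ) with hs
  set r := (∑ i, ((d - 1 + F.e i : ℕ) : ℚ) ^ 2 - ∑ j, (F.c j : ℚ) ^ 2 - 3 * (d - 1 : ℕ) ^ 2) / 2
  have hb : ∀ k : ℕ, K + 2 * (d - 1) ≤ k →
      0 ≤ jacobianHilbert f k ∧ jacobianHilbert f k ≤ ((d - 1) ^ 2 : ℕ) := by
    intro k hk
    have h1 := choose_le_finrank_degreePart_jacobian hd hf hred (k := k) (by omega)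
    have h2 : Module.finrank ℂ (degreePart (fun _ => 0) k (jacobian f)) ≤ (k + 2).choose 2 := by
      have h3 : Module.finrank ℂ (homogeneousVec (fun _ : Unit => 0) k) = (k + 2).choose 2 := by
        rw [finrank_homogeneousVec (fun _ => Nat.zero_le _)]
        simp
      exact (Submodule.finrank_mono inf_le_left).trans h3.le
    rw [jacobianHilbert]
    constructor
    · rw [sub_nonneg]
      exact_mod_cast h2
    · rw [sub_le_iff_le_add']
      exact_mod_cast h1
  have h0 := eq_zero_of_quadratic_bounded (α := ((m : ℚ) - n - 2) / 2)
    (β := 3 / 2 * ((m : ℚ) - n - 2) - s) (γ := ((m : ℚ) - n - 2) - 3 / 2 * s + r)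
    (B := ((d - 1) ^ 2 : ℕ)) (K := K + 2 * (d - 1)) (by
      intro k hk
      have h1 := hb k hk
      rw [hK k (by omega)] at h1
      constructor
      · linarith [h1.1]
      · linarith [h1.2])
  have hm : (m : ℚ) - n - 2 = 0 := by linarith [h0.1]
  have hs0 : s = 0 := by linarith [h0.2]
  refine ⟨?_, by linarith, K, fun k hk => ?_⟩
  · have : (m : ℚ) = ((n + 2 : ℕ) : ℚ) := by push_cast; linarith
    exact_mod_cast this
  · rw [hK k hk, hm, hs0]
    ring

end MinimalResolution

/-! ### Dehomogenization and homogenization -/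

theorem aeval_smul_of_isHomogeneous {A : Type*} [CommRing A] [Algebra ℂ A] {F : S} {k : ℕ}
    (hF : F.IsHomogeneous k) (c : A) (v : Fin 3 → A) :
    aeval (fun j => c * v j) F = c ^ k * aeval v F := by
  rw [aeval_def, aeval_def, eval₂_eq', eval₂_eq', Finset.mul_sum]
  refine Finset.sum_congr rfl fun μ hμ => ?_
  have h1 : ∑ i, μ i = k := by
    rw [← Finsupp.degree_eq_sum, Finsupp.degree_eq_weight_one]
    exact hF (mem_support_iff.mp hμ)
  simp only [mul_pow, Finset.prod_mul_distrib, Finset.prod_pow_eq_pow_sum, h1]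
  ring

theorem eval_smul_of_isHomogeneous {F : S} {k : ℕ} (hF : F.IsHomogeneous k) (c : ℂ)
    (v : Fin 3 → ℂ) : eval (c • v) F = c ^ k * eval v F := by
  have := aeval_smul_of_isHomogeneous hF c v
  simp only [← coe_aeval_eq_eval]
  exact this

/-- Restriction to the affine chart `x_i = 1`. -/
def dehomogenize (i : Fin 3) : S →ₐ[ℂ] MvPolynomial (Fin 2) ℂ :=
  aeval (i.insertNth (1 : MvPolynomial (Fin 2) ℂ) X : Fin 3 → MvPolynomial (Fin 2) ℂ)

theorem affineEquation_eq (f : S) (i : Fin 3) : affineEquation f i = dehomogenize i f := rfl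

@[simp]
theorem dehomogenize_X_self (i : Fin 3) : dehomogenize i (X i) = 1 := by
  simp [dehomogenize]

@[simp]
theorem dehomogenize_X_succAbove (i : Fin 3) (k : Fin 2) :
    dehomogenize i (X (i.succAbove k)) = X k := by
  simp [dehomogenize]

theorem pderiv_dehomogenize (i : Fin 3) (k : Fin 2) (F : S) :
    pderiv k (dehomogenize i F) = dehomogenize i (pderiv (i.succAbove k) F) := by
  induction F using MvPolynomial.induction_on with
  | C a => simp [dehomogenize, algebraMap_eq]
  | add p q hp hq => simp only [map_add, hp, hq]
  | mul_X p j hp =>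
    have hX : pderiv k (dehomogenize i (X j)) =
        dehomogenize i (pderiv (i.succAbove k) (X j)) := by
      rcases Fin.eq_self_or_eq_succAbove i j with rfl | ⟨l, rfl⟩
      · rw [dehomogenize_X_self, pderiv_one, pderiv_X_of_ne (Fin.succAbove_ne _ _).symm, map_zero]
      · rw [dehomogenize_X_succAbove]
        by_cases h : l = k
        · rw [h, pderiv_X_self, pderiv_X_self, map_one]
        · rw [pderiv_X_of_ne h, pderiv_X_of_ne (fun e => h (Fin.succAbove_right_injective e)),
            map_zero]
    rw [map_mul, pderiv_mul, pderiv_mul, map_add, map_mul, map_mul, hp, hX]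

theorem eval_eq_of_isHomogeneous {F : S} {k : ℕ} (hF : F.IsHomogeneous k) (i : Fin 3)
    {v : Fin 3 → ℂ} (hv : v i ≠ 0) :
    eval v F = v i ^ k * eval (fun l => v (i.succAbove l) / v i) (dehomogenize i F) := by
  set w : Fin 2 → ℂ := fun l => v (i.succAbove l) / v i with hw
  have h1 : eval w (dehomogenize i F) = eval (i.insertNth 1 w) F := by
    have : (aeval w).comp (dehomogenize i) = aeval (i.insertNth 1 w : Fin 3 → ℂ) := by
      ext j
      rcases Fin.eq_self_or_eq_succAbove i j with rfl | ⟨l, rfl⟩ <;> simp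
    simp only [← coe_aeval_eq_eval]
    exact DFunLike.congr_fun this F
  rw [h1, ← eval_smul_of_isHomogeneous hF]
  congr 2
  funext j
  rcases Fin.eq_self_or_eq_succAbove i j with rfl | ⟨l, rfl⟩
  · simp
  · simp [hw, mul_div_cancel₀ _ hv]

/-- The affine equation determines values only where the `i`-th coordinate is nonzero; multiplying
by `X i` takes care of the remaining points. -/
theorem eq_zero_of_dehomogenize_eq_zero {F : S} {k : ℕ} (hF : F.IsHomogeneous k) (i : Fin 3)
    (h : dehomogenize i F = 0) : F = 0 := by
  have h1 : X i * F = 0 := by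
    refine MvPolynomial.funext fun v => ?_
    rw [map_mul, eval_X, map_zero, mul_eq_zero]
    by_cases hv : v i = 0
    · exact Or.inl hv
    · right
      rw [eval_eq_of_isHomogeneous hF i hv, h, map_zero, mul_zero]
  exact (mul_eq_zero.mp h1).resolve_left (X_ne_zero i)

theorem exists_isHomogeneous_dehomogenize_eq (i : Fin 3) (s : MvPolynomial (Fin 2) ℂ) {N : ℕ}
    (hN : s.totalDegree ≤ N) : ∃ F : S, F.IsHomogeneous N ∧ dehomogenize i F = s := by
  refine ⟨∑ j ∈ Finset.range (s.totalDegree + 1),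
    X i ^ (N - j) * rename i.succAbove (homogeneousComponent j s), ?_, ?_⟩
  · refine IsHomogeneous.sum _ _ _ fun j hj => ?_
    have h1 := (isHomogeneous_X_pow (R := ℂ) i (N - j)).mul
      ((homogeneousComponent_isHomogeneous j s).rename_isHomogeneous (f := i.succAbove))
    rwa [Nat.sub_add_cancel (by rw [Finset.mem_range] at hj; omega)] at h1
  · have h1 : ∀ p, dehomogenize i (rename i.succAbove p) = p := by
      intro p
      rw [dehomogenize, aeval_rename]
      have : (i.insertNth (1 : MvPolynomial (Fin 2) ℂ) X : Fin 3 → MvPolynomial (Fin 2) ℂ) ∘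
          i.succAbove = X := by
        funext l
        simp
      rw [this, aeval_X_left_apply]
    simp only [map_sum, map_mul, map_pow, dehomogenize_X_self, one_pow, one_mul, h1]
    exact sum_homogeneousComponent s

/-! ### The Jacobian ideal and the Tjurina algebras -/

/-- The Jacobian ideal. -/
def jacobianIdeal (f : S) : Ideal S := Ideal.span (Set.range fun j => pderiv j f)

theorem mem_jacobian_iff {f p : S} : (fun _ : Unit => p) ∈ jacobian f ↔ p ∈ jacobianIdeal f := by
  rw [jacobian, jacobianIdeal, ← Fintype.range_linearCombination,
    Ideal.mem_span_range_iff_exists_fun]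
  constructor
  · rintro ⟨c, hc⟩
    refine ⟨c, ?_⟩
    have := congrFun hc ()
    simpa [Fintype.linearCombination_apply, gradient] using this
  · rintro ⟨c, hc⟩
    refine ⟨c, ?_⟩
    funext x
    simpa [Fintype.linearCombination_apply, gradient] using hc

theorem mem_jacobianIdeal_of_isHomogeneous {f : S} {d : ℕ} (hd : d ≠ 0) (hf : f.IsHomogeneous d) :
    f ∈ jacobianIdeal f := by
  have h1 : (d : S) * C ((d : ℂ)⁻¹) = 1 := by
    rw [← C_eq_coe_nat, ← C_mul, mul_inv_cancel₀ (by exact_mod_cast hd), C_1]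
  have h2 : f = C ((d : ℂ)⁻¹) * (d • f) := by
    rw [nsmul_eq_mul]
    linear_combination -f * h1
  have h3 : d • f ∈ jacobianIdeal f := by
    rw [← hf.sum_X_mul_pderiv]
    exact Ideal.sum_mem _ fun j _ => Ideal.mul_mem_left _ _ (Ideal.subset_span ⟨j, rfl⟩)
  have h4 := Ideal.mul_mem_left _ (C ((d : ℂ)⁻¹)) h3
  rwa [← h2] at h4

/-- By Euler's identity, the ideal `(g, g_u, g_v)` is the restriction of the Jacobian ideal. -/
theorem span_affineEquation_eq {f : S} {d : ℕ} (hd : d ≠ 0) (hf : f.IsHomogeneous d) (i : Fin 3) :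
    Ideal.span {affineEquation f i, pderiv 0 (affineEquation f i),
      pderiv 1 (affineEquation f i)} =
      Ideal.span (Set.range fun j => dehomogenize i (pderiv j f)) := by
  have hJ : (jacobianIdeal f).map (dehomogenize i) =
      Ideal.span (Set.range fun j => dehomogenize i (pderiv j f)) := by
    rw [jacobianIdeal, Ideal.map_span, ← Set.range_comp]
    rfl
  simp only [affineEquation_eq, pderiv_dehomogenize]
  apply le_antisymm
  · rw [Ideal.span_le]
    rintro _ (rfl | rfl | rfl)
    · rw [← hJ]
      exact Ideal.mem_map_of_mem _ (mem_jacobianIdeal_of_isHomogeneous hd hf)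
    · exact Ideal.subset_span ⟨_, rfl⟩
    · exact Ideal.subset_span ⟨_, rfl⟩
  · rw [Ideal.span_le]
    have hl : ∀ l : Fin 2, dehomogenize i (pderiv (i.succAbove l) f) ∈
        Ideal.span {dehomogenize i f, dehomogenize i (pderiv (i.succAbove 0) f),
          dehomogenize i (pderiv (i.succAbove 1) f)} := by
      intro l
      apply Ideal.subset_span
      fin_cases l <;> simp
    rintro _ ⟨j, rfl⟩
    rcases Fin.eq_self_or_eq_succAbove i j with rfl | ⟨l, rfl⟩
    · have h1 := congrArg (dehomogenize j) hf.sum_X_mul_pderiv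
      rw [Fin.sum_univ_succAbove _ j] at h1
      simp only [map_add, map_sum, map_mul, dehomogenize_X_self, dehomogenize_X_succAbove,
        one_mul, map_nsmul] at h1
      change dehomogenize j (pderiv j f) ∈ _
      rw [eq_sub_of_add_eq h1]
      refine Ideal.sub_mem _ (nsmul_mem (Ideal.subset_span (by simp)) _)
        (Ideal.sum_mem _ fun l _ => Ideal.mul_mem_left _ _ (hl l))
    · exact hl l

/-- The germ at `p` of a polynomial, modulo the Tjurina ideal. -/
def tjurinaMap (f : S) (p : Plane) : S →ₐ[ℂ] TjurinaAlgebra f p :=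
  ((Ideal.Quotient.mkₐ ℂ (tjurinaIdeal f p)).comp
    (IsScalarTower.toAlgHom ℂ (MvPolynomial (Fin 2) ℂ) (LocalRingAt p))).comp
    (dehomogenize (chart p))

theorem tjurinaMap_eq_zero_iff {f : S} {d : ℕ} (hd : d ≠ 0) (hf : f.IsHomogeneous d) (p : Plane)
    (F : S) : tjurinaMap f p F = 0 ↔ ∃ s, eval (affinePoint p) s ≠ 0 ∧
      s * dehomogenize (chart p) F ∈
        Ideal.span (Set.range fun j => dehomogenize (chart p) (pderiv j f)) := by
  change Ideal.Quotient.mk (tjurinaIdeal f p) (algebraMap _ _ (dehomogenize (chart p) F)) = 0 ↔ _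
  rw [Ideal.Quotient.eq_zero_iff_mem, tjurinaIdeal, span_affineEquation_eq hd hf,
    IsLocalization.algebraMap_mem_map_algebraMap_iff (pointIdeal p).primeCompl]
  rfl

theorem tjurinaMap_eq_zero_of_mem {f : S} {d : ℕ} (hd : d ≠ 0) (hf : f.IsHomogeneous d)
    (p : Plane) {F : S} (hF : F ∈ jacobianIdeal f) : tjurinaMap f p F = 0 := by
  rw [tjurinaMap_eq_zero_iff hd hf]
  refine ⟨1, by simp, ?_⟩
  rw [one_mul]
  have := Ideal.mem_map_of_mem (dehomogenize (chart p)) hF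
  rw [jacobianIdeal, Ideal.map_span, ← Set.range_comp] at this
  exact this

theorem chart_spec (p : Plane) : p.rep (chart p) ≠ 0 := (exists_coord_ne_zero p).choose_spec

theorem eval_rep_of_isHomogeneous {F : S} {k : ℕ} (hF : F.IsHomogeneous k) (p : Plane) :
    eval p.rep F =
      p.rep (chart p) ^ k * eval (affinePoint p) (dehomogenize (chart p) F) :=
  eval_eq_of_isHomogeneous hF (chart p) (chart_spec p)

theorem mem_singularPoints_iff {f : S} {d : ℕ} (hd : d ≠ 0) (hf : f.IsHomogeneous d) {p : Plane} :
    p ∈ singularPoints f ↔ ∀ i, eval p.rep (pderiv i f) = 0 := by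
  refine ⟨fun h => h.2, fun h => ⟨?_, h⟩⟩
  have h1 : jacobianIdeal f ≤ RingHom.ker (eval p.rep) := by
    rw [jacobianIdeal, Ideal.span_le]
    rintro _ ⟨j, rfl⟩
    exact h j
  exact h1 (mem_jacobianIdeal_of_isHomogeneous hd hf)

/-- A form that vanishes in all Tjurina algebras is in the saturation of the Jacobian ideal. -/
theorem exists_pow_idealOfVars_mul_mem {f : S} {d : ℕ} (hd : d ≠ 0) (hf : f.IsHomogeneous d)
    {F : S} {k : ℕ} (hF : F.IsHomogeneous k)
    (h : ∀ p ∈ singularPoints f, tjurinaMap f p F = 0) :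
    ∃ N, ∀ G ∈ idealOfVars (Fin 3) ℂ ^ N, G * F ∈ jacobianIdeal f := by
  -- The colon ideal $(J_f:F)$. Its only zero will be the origin, so by the Nullstellensatz it
  -- contains a power of $\mathfrak m$.
  let K : Ideal S := Submodule.comap (LinearMap.toSpanSingleton S S F) (jacobianIdeal f)
  have hK : ∀ G, G ∈ K ↔ G * F ∈ jacobianIdeal f := fun G => Iff.rfl
  have hzero : ∀ v ∈ zeroLocus ℂ K, v = 0 := by
    intro v hv
    by_contra hne
    have hv' : ∀ G, G * F ∈ jacobianIdeal f → eval v G = 0 := hv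
    set p : Plane := Projectivization.mk ℂ v hne with hp
    obtain ⟨a, ha⟩ := Projectivization.exists_smul_eq_mk_rep ℂ v hne
    rw [← hp] at ha
    have hrep : ∀ {G : S} {e : ℕ}, G.IsHomogeneous e → G * F ∈ jacobianIdeal f →
        eval p.rep G = 0 := by
      intro G e hG hGF
      rw [← ha, Units.smul_def, eval_smul_of_isHomogeneous hG, hv' G hGF, mul_zero]
    -- The partials lie in the colon ideal, so its nonzero zeros give singular points.
    have hsing : p ∈ singularPoints f := (mem_singularPoints_iff hd hf).mpr fun i =>
      hrep hf.pderiv (Ideal.mul_mem_right _ _ (Ideal.subset_span ⟨i, rfl⟩))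
    obtain ⟨s, hs, hmem⟩ := (tjurinaMap_eq_zero_iff hd hf p F).mp (h p hsing)
    rw [Ideal.mem_span_range_iff_exists_fun] at hmem
    obtain ⟨c, hc⟩ := hmem
    -- Degrees are chosen so that `Hs * F` and all `H j * pderiv j f` have degree `N + (d - 1) + k`.
    -- The affine identity then lifts to a homogeneous one, and `Hs` is in the colon ideal without
    -- vanishing at `p`.
    set N := s.totalDegree + ∑ j, (c j).totalDegree with hN
    obtain ⟨Hs, hHs, hs'⟩ := exists_isHomogeneous_dehomogenize_eq (chart p) s
      (N := N + (d - 1)) (by omega)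
    have hcN : ∀ j, (c j).totalDegree ≤ N + k := fun j =>
      (Finset.single_le_sum (f := fun j => (c j).totalDegree) (fun _ _ => Nat.zero_le _)
        (Finset.mem_univ j)).trans (by omega)
    choose H hH hHc using fun j =>
      exists_isHomogeneous_dehomogenize_eq (chart p) (c j) (hcN j)
    have hhom : (Hs * F - ∑ j, H j * pderiv j f).IsHomogeneous (N + (d - 1) + k) := by
      refine (hHs.mul hF).sub (IsHomogeneous.sum _ _ _ fun j _ => ?_)
      have := (hH j).mul (hf.pderiv (i := j))
      rwa [add_right_comm] at this
    have h0 := eq_zero_of_dehomogenize_eq_zero hhom (chart p) (by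
      simp only [map_sub, map_mul, map_sum, hs', hHc, hc, sub_self])
    have hHsF : Hs * F ∈ jacobianIdeal f := by
      rw [sub_eq_zero.mp h0]
      exact Ideal.sum_mem _ fun j _ => Ideal.mul_mem_left _ _ (Ideal.subset_span ⟨j, rfl⟩)
    have h1 := hrep hHs hHsF
    rw [eval_rep_of_isHomogeneous hHs, hs'] at h1
    exact (mul_ne_zero (pow_ne_zero _ (chart_spec p)) hs) h1
  have hrad : idealOfVars (Fin 3) ℂ ≤ K.radical := by
    rw [← vanishingIdeal_zeroLocus_eq_radical (K := ℂ), idealOfVars, Ideal.span_le]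
    rintro _ ⟨j, rfl⟩
    intro v hv
    rw [hzero v hv]
    simp
  exact Ideal.exists_pow_le_of_le_radical_of_fg hrad (idealOfVars_fg _ _)

/-- In large degrees, the Jacobian ideal contains all forms that vanish in the Tjurina algebras. -/
theorem exists_forall_mem_jacobianIdeal {f : S} {d : ℕ} (hd : d ≠ 0) (hf : f.IsHomogeneous d) :
    ∃ k₀, ∀ k, k₀ ≤ k → ∀ F : S, F.IsHomogeneous k →
      (∀ p ∈ singularPoints f, tjurinaMap f p F = 0) → F ∈ jacobianIdeal f := by
  let T : Set S := {F | (∃ k, F.IsHomogeneous k) ∧ ∀ p ∈ singularPoints f, tjurinaMap f p F = 0}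
  -- Finitely many forms generate the ideal, so the exponents `N g` have a common bound.
  obtain ⟨t, htT, ht⟩ := (Submodule.fg_span_iff_fg_span_finset_subset (R := S) T).mp
    (IsNoetherian.noetherian _)
  have hex : ∀ g : t, ∃ e N, (g : S).IsHomogeneous e ∧
      ∀ G ∈ idealOfVars (Fin 3) ℂ ^ N, G * g ∈ jacobianIdeal f := by
    intro g
    obtain ⟨⟨e, he⟩, h⟩ := htT g.2
    obtain ⟨N, hN⟩ := exists_pow_idealOfVars_mul_mem hd hf he h
    exact ⟨e, N, he, hN⟩
  choose e N he hN using hex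
  refine ⟨∑ g, (e g + N g), fun k hk F hF h => ?_⟩
  have hFt : F ∈ Submodule.span S (Set.range ((↑) : t → S)) := by
    have : F ∈ Submodule.span S T := Submodule.subset_span ⟨⟨k, hF⟩, h⟩
    rw [ht] at this
    simpa using this
  rw [← Fintype.range_linearCombination] at hFt
  obtain ⟨u, hu⟩ := hFt
  rw [Fintype.linearCombination_apply] at hu
  rw [← homogeneousComponent_eq_self hF, ← hu, map_sum]
  refine Ideal.sum_mem _ fun g _ => ?_
  have hg : e g + N g ≤ k := (Finset.single_le_sum (f := fun g => e g + N g)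
    (fun _ _ => Nat.zero_le _) (Finset.mem_univ g)).trans hk
  rw [smul_eq_mul, homogeneousComponent_mul_of_isHomogeneous (he g), if_pos (by omega)]
  -- The coefficient of `g` is now a form of degree `k - e g ≥ N g`, hence in $\mathfrak m^{N_g}$.
  refine hN g _ ?_
  rw [mem_pow_idealOfVars_iff']
  intro μ hμ
  rw [coeff_homogeneousComponent, if_neg (by omega)]

/-! ### Forms of large degree generate the Tjurina algebras -/

section HilbertBound

variable {A : Type*} [CommRing A] [Algebra ℂ A]

theorem finrank_map_homogeneousSubmodule_add (Ψ : S →ₐ[ℂ] A) (k : ℕ) :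
    Module.finrank ℂ ((homogeneousSubmodule (Fin 3) ℂ k).map Ψ.toLinearMap) +
      Module.finrank ℂ (homogeneousSubmodule (Fin 3) ℂ k ⊓ LinearMap.ker Ψ.toLinearMap : Submodule ℂ S) =
      (k + 2).choose 2 := by
  have h := LinearMap.finrank_range_add_finrank_ker
    (Ψ.toLinearMap.domRestrict (homogeneousSubmodule (Fin 3) ℂ k))
  have h2 : (LinearMap.ker (Ψ.toLinearMap.domRestrict (homogeneousSubmodule (Fin 3) ℂ k))).map
      (homogeneousSubmodule (Fin 3) ℂ k).subtype =
      homogeneousSubmodule (Fin 3) ℂ k ⊓ LinearMap.ker Ψ.toLinearMap := by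
    rw [LinearMap.ker_domRestrict]
    change Submodule.map _ (Submodule.comap _ _) = _
    rw [Submodule.map_comap_subtype]
  rw [LinearMap.range_domRestrict, finrank_homogeneousSubmodule] at h
  rw [← h2, Submodule.finrank_map_subtype_eq]
  exact h

theorem finrank_degreePart_jacobian_eq (f : S) (k : ℕ) :
    Module.finrank ℂ (degreePart (fun _ => 0) k (jacobian f)) =
      Module.finrank ℂ (homogeneousSubmodule (Fin 3) ℂ k ⊓
        (jacobianIdeal f).restrictScalars ℂ : Submodule ℂ S) := by
  let g : S →ₗ[ℂ] (Unit → S) := LinearMap.pi fun _ => LinearMap.id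
  have hg : Function.Injective g := fun p q h => congrFun h ()
  have : degreePart (fun _ => 0) k (jacobian f) = (homogeneousSubmodule (Fin 3) ℂ k ⊓
      (jacobianIdeal f).restrictScalars ℂ : Submodule ℂ S).map g := by
    ext v
    constructor
    · rintro ⟨h1, h2⟩
      exact ⟨v (), ⟨h1.isHomogeneous (), mem_jacobian_iff.mp h2⟩, rfl⟩
    · rintro ⟨p, ⟨h1, h2⟩, rfl⟩
      exact ⟨isHomogeneousVec_unit h1, mem_jacobian_iff.mpr h2⟩
  rw [this]
  exact (Submodule.equivMapOfInjective g hg _).finrank_eq.symm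

theorem finrank_map_homogeneousSubmodule_le {f : S} {Ψ : S →ₐ[ℂ] A} {k : ℕ}
    (h : ∀ F : S, F.IsHomogeneous k → F ∈ jacobianIdeal f → Ψ F = 0) :
    (Module.finrank ℂ ((homogeneousSubmodule (Fin 3) ℂ k).map Ψ.toLinearMap) : ℚ) ≤ jacobianHilbert f k := by
  have h1 := finrank_map_homogeneousSubmodule_add Ψ k
  have h2 : (homogeneousSubmodule (Fin 3) ℂ k ⊓
      (jacobianIdeal f).restrictScalars ℂ : Submodule ℂ S) ≤
      homogeneousSubmodule (Fin 3) ℂ k ⊓ LinearMap.ker Ψ.toLinearMap :=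
    le_inf inf_le_left fun F hF => h F hF.1 hF.2
  have : Module.Finite ℂ (homogeneousSubmodule (Fin 3) ℂ k ⊓ LinearMap.ker Ψ.toLinearMap : Submodule ℂ S) :=
    Submodule.finiteDimensional_of_le inf_le_left
  have h3 := Submodule.finrank_mono h2
  rw [jacobianHilbert, finrank_degreePart_jacobian_eq, ← h1]
  push_cast
  have : (Module.finrank ℂ (homogeneousSubmodule (Fin 3) ℂ k ⊓
      (jacobianIdeal f).restrictScalars ℂ : Submodule ℂ S) : ℚ) ≤
      Module.finrank ℂ (homogeneousSubmodule (Fin 3) ℂ k ⊓ LinearMap.ker Ψ.toLinearMap : Submodule ℂ S) := by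
    exact_mod_cast h3
  linarith

theorem finrank_map_homogeneousSubmodule_eq {f : S} {Ψ : S →ₐ[ℂ] A} {k : ℕ}
    (h : ∀ F : S, F.IsHomogeneous k → (F ∈ jacobianIdeal f ↔ Ψ F = 0)) :
    (Module.finrank ℂ ((homogeneousSubmodule (Fin 3) ℂ k).map Ψ.toLinearMap) : ℚ) = jacobianHilbert f k := by
  have h1 := finrank_map_homogeneousSubmodule_add Ψ k
  have h2 : (homogeneousSubmodule (Fin 3) ℂ k ⊓
      (jacobianIdeal f).restrictScalars ℂ : Submodule ℂ S) =
      homogeneousSubmodule (Fin 3) ℂ k ⊓ LinearMap.ker Ψ.toLinearMap := by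
    ext F
    exact ⟨fun hF => ⟨hF.1, (h F hF.1).mp hF.2⟩, fun hF => ⟨hF.1, (h F hF.1).mpr hF.2⟩⟩
  rw [jacobianHilbert, finrank_degreePart_jacobian_eq, ← h1, h2]
  push_cast
  ring

theorem exists_forall_ge_eq_of_finrank_le {W : ℕ → Submodule ℂ A} (hW : Monotone W)
    [∀ k, Module.Finite ℂ (W k)] {K B : ℕ} (hB : ∀ k, K ≤ k → Module.finrank ℂ (W k) ≤ B) :
    ∃ k₀, ∀ k, k₀ ≤ k → W k = W k₀ := by
  have hbdd : BddAbove (Set.range fun j => Module.finrank ℂ (W (K + j))) :=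
    ⟨B, by rintro _ ⟨j, rfl⟩; exact hB _ (by omega)⟩
  obtain ⟨j, hj⟩ := Nat.sSup_mem (Set.range_nonempty _) hbdd
  refine ⟨K + j, fun k hk => (Submodule.eq_of_le_of_finrank_le (hW hk) ?_).symm⟩
  obtain ⟨i, rfl⟩ : ∃ i, k = K + i := ⟨k - K, by omega⟩
  exact (le_csSup hbdd ⟨i, rfl⟩).trans hj.ge

end HilbertBound

/-- Multiplication by `l` does not change the image under `Ψ`, so the images of the degree parts
increase with the degree. Their dimensions are bounded by the Hilbert function of the Jacobian
algebra, so they stabilize, and the stable space contains the image of every form. -/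
theorem map_homogeneousSubmodule_eq_range {A : Type*} [CommRing A] [Algebra ℂ A] {f : S} {d : ℕ}
    (hd : d ≠ 0) (hf : f.IsHomogeneous d) (hred : Squarefree f) {Ψ : S →ₐ[ℂ] A} {l : S}
    (hl : l.IsHomogeneous 1) (hl1 : Ψ l = 1)
    (h : ∀ k, ∀ F : S, F.IsHomogeneous k → F ∈ jacobianIdeal f → Ψ F = 0) :
    ∃ k₀, ∀ k, k₀ ≤ k →
      (homogeneousSubmodule (Fin 3) ℂ k).map Ψ.toLinearMap = LinearMap.range Ψ.toLinearMap := by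
  set W : ℕ → Submodule ℂ A := fun k => (homogeneousSubmodule (Fin 3) ℂ k).map Ψ.toLinearMap with hW
  have hmono : Monotone W := by
    refine monotone_nat_of_le_succ fun k => ?_
    rintro _ ⟨F, hF, rfl⟩
    refine ⟨F * l, hF.mul hl, ?_⟩
    change Ψ (F * l) = Ψ F
    rw [map_mul, hl1, mul_one]
  have hfin : ∀ k, Module.Finite ℂ (W k) := fun k => Module.Finite.map _ _
  obtain ⟨k₀, hk₀⟩ := exists_forall_ge_eq_of_finrank_le hmono (K := 2 * (d - 1))
    (B := (d - 1) ^ 2) (by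
      intro k hk
      have h1 := finrank_map_homogeneousSubmodule_le (Ψ := Ψ) (h k)
      have h2 := choose_le_finrank_degreePart_jacobian hd hf hred hk
      have h3 : ((k + 2).choose 2 : ℚ) ≤
          Module.finrank ℂ (degreePart (fun _ => 0) k (jacobian f)) + ((d - 1) ^ 2 : ℕ) := by
        exact_mod_cast h2
      rw [jacobianHilbert] at h1
      have h4 : (Module.finrank ℂ (W k) : ℚ) ≤ ((d - 1) ^ 2 : ℕ) := by linarith
      exact_mod_cast h4)
  refine ⟨k₀, fun k hk => le_antisymm LinearMap.map_le_range ?_⟩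
  change _ ≤ W k
  rw [hk₀ k hk]
  rintro _ ⟨F, rfl⟩
  rw [← sum_homogeneousComponent F, map_sum]
  refine Submodule.sum_mem _ fun j _ => ?_
  have h1 : Ψ.toLinearMap (homogeneousComponent j F) ∈ W j :=
    ⟨_, homogeneousComponent_isHomogeneous j F, rfl⟩
  rw [← hk₀ (max j k₀) (le_max_right _ _)]
  exact hmono (le_max_left _ _) h1

/-! ### Products of local algebras generated by homogeneous fractions -/

section Normalization

variable {A : Type*} [CommRing A] [Algebra ℂ A]

/-- A homomorphism from `S`, made inhomogeneous by dividing forms by a power of the linear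
form `l`. -/
def normalizedMap (τ : S →ₐ[ℂ] A) (l : S) : S →ₐ[ℂ] A :=
  aeval fun j => Ring.inverse (τ l) * τ (X j)

variable {τ : S →ₐ[ℂ] A} {l : S}

theorem normalizedMap_of_isHomogeneous (τ : S →ₐ[ℂ] A) (l : S) {F : S} {k : ℕ}
    (hF : F.IsHomogeneous k) : normalizedMap τ l F = Ring.inverse (τ l) ^ k * τ F := by
  rw [normalizedMap, aeval_smul_of_isHomogeneous hF]
  congr 1
  exact (DFunLike.congr_fun (aeval_unique τ) F).symm

theorem normalizedMap_eq_zero_iff (hl : IsUnit (τ l)) {F : S} {k : ℕ} (hF : F.IsHomogeneous k) :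
    normalizedMap τ l F = 0 ↔ τ F = 0 := by
  rw [normalizedMap_of_isHomogeneous τ l hF]
  exact (hl.ringInverse.pow k).mul_right_eq_zero

theorem normalizedMap_self (hl : IsUnit (τ l)) (hl1 : l.IsHomogeneous 1) :
    normalizedMap τ l l = 1 := by
  rw [normalizedMap_of_isHomogeneous τ l hl1, pow_one, Ring.inverse_mul_cancel _ hl]

theorem isUnit_normalizedMap_iff (hl : IsUnit (τ l)) {F : S} {k : ℕ} (hF : F.IsHomogeneous k) :
    IsUnit (normalizedMap τ l F) ↔ IsUnit (τ F) := by
  rw [normalizedMap_of_isHomogeneous τ l hF, IsUnit.mul_iff,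
    and_iff_right (hl.ringInverse.pow k)]

/-- Injective multiplication on a finite-dimensional space is surjective, so the inverse stays in
the subalgebra. -/
theorem exists_mul_eq_one_of_isUnit {R : Subalgebra ℂ A}
    [Module.Finite ℂ R] {x : A} (hx : x ∈ R) (hu : IsUnit x) : ∃ y ∈ R, x * y = 1 := by
  let g : R →ₗ[ℂ] R := LinearMap.mulLeft ℂ ⟨x, hx⟩
  have hg : Function.Injective g := by
    intro a b h
    exact Subtype.ext (hu.mul_left_cancel (congrArg Subtype.val h))
  obtain ⟨y, hy⟩ := LinearMap.injective_iff_surjective.mp hg 1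
  exact ⟨y, y.2, congrArg Subtype.val hy⟩

theorem finite_range_of_map_homogeneousSubmodule_eq {Ψ : S →ₐ[ℂ] A} {k : ℕ}
    (h : (homogeneousSubmodule (Fin 3) ℂ k).map Ψ.toLinearMap = LinearMap.range Ψ.toLinearMap) :
    Module.Finite ℂ Ψ.range := by
  change Module.Finite ℂ (LinearMap.range Ψ.toLinearMap)
  rw [← h]
  exact Module.Finite.map _ _

/-- The range is a finite-dimensional subalgebra, hence closed under inverting units of `A`. It
contains the inverse of `τ l` as the image of `X i`, then `τ l`, then every `τ F`, then every
fraction. Finite-dimensionality of `A` is thus a conclusion and not an assumption. -/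
theorem normalizedMap_surjective {f : S} {d : ℕ} (hd : d ≠ 0) (hf : f.IsHomogeneous d)
    (hred : Squarefree f) (hτ : ∀ F ∈ jacobianIdeal f, τ F = 0) {i : Fin 3} (hi : τ (X i) = 1)
    (hfrac : ∀ x, ∃ F G, IsUnit (τ G) ∧ x * τ G = τ F)
    (hl : IsUnit (τ l)) (hl1 : l.IsHomogeneous 1) :
    Function.Surjective (normalizedMap τ l) ∧ Module.Finite ℂ A := by
  obtain ⟨k, hk⟩ := map_homogeneousSubmodule_eq_range hd hf hred hl1 (normalizedMap_self hl hl1)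
    fun k F hF hFJ => (normalizedMap_eq_zero_iff hl hF).mpr (hτ F hFJ)
  have hfin := finite_range_of_map_homogeneousSubmodule_eq (hk k le_rfl)
  set R := (normalizedMap τ l).range with hR
  have hinv : Ring.inverse (τ l) ∈ R := by
    refine ⟨X i, ?_⟩
    change normalizedMap τ l (X i) = _
    rw [normalizedMap_of_isHomogeneous τ l (isHomogeneous_X ℂ _), pow_one, hi, mul_one]
  have hlam : τ l ∈ R := by
    obtain ⟨y, hy, hy1⟩ := exists_mul_eq_one_of_isUnit hinv hl.ringInverse
    have : y = τ l := by
      rw [← one_mul y, ← Ring.mul_inverse_cancel _ hl, mul_assoc, hy1, mul_one]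
    exact this ▸ hy
  have htj : ∀ F, τ F ∈ R := by
    intro F
    rw [← sum_homogeneousComponent F, map_sum]
    refine Subalgebra.sum_mem _ fun j _ => ?_
    have h1 := normalizedMap_of_isHomogeneous τ l (homogeneousComponent_isHomogeneous j F)
    have h2 : τ (homogeneousComponent j F) =
        τ l ^ j * normalizedMap τ l (homogeneousComponent j F) := by
      rw [h1, ← mul_assoc, ← mul_pow, Ring.mul_inverse_cancel _ hl, one_pow, one_mul]
    rw [h2]
    exact R.mul_mem (R.pow_mem hlam j) ⟨_, rfl⟩
  have hsurj : Function.Surjective (normalizedMap τ l) := by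
    intro x
    change x ∈ R
    obtain ⟨F, G, hG, hx⟩ := hfrac x
    obtain ⟨y, hy, hy1⟩ := exists_mul_eq_one_of_isUnit (htj G) hG
    rw [← mul_one x, ← hy1, ← mul_assoc, hx]
    exact R.mul_mem (htj F) hy
  refine ⟨hsurj, ?_⟩
  have : Function.Surjective (R.val : R → A) := fun x => ⟨⟨x, hsurj x⟩, rfl⟩
  exact Module.Finite.of_surjective R.val.toLinearMap this

theorem isNilpotent_of_not_isUnit [Module.Finite ℂ A]
    [IsLocalRing A] {x : A} (hx : ¬ IsUnit x) : IsNilpotent x := by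
  have : IsArtinianRing A := IsArtinianRing.of_finite ℂ A
  rwa [Ring.KrullDimLE.isNilpotent_iff_mem_maximalIdeal, IsLocalRing.mem_maximalIdeal,
    mem_nonunits_iff]

/-- A nonunit of a finite-dimensional local algebra is nilpotent, so a power of `F` dies in the
first algebra while remaining invertible in the second. This feeds the Chinese remainder theorem. -/
theorem isCoprime_ker_of_separating {A₁ A₂ : Type*} [CommRing A₁] [Algebra ℂ A₁]
    [Module.Finite ℂ A₁] [IsLocalRing A₁] [CommRing A₂] [Algebra ℂ A₂]
    {Ψ₁ : S →ₐ[ℂ] A₁} {Ψ₂ : S →ₐ[ℂ] A₂} (hsurj : Function.Surjective Ψ₂) {F : S}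
    (h₁ : ¬ IsUnit (Ψ₁ F)) (h₂ : IsUnit (Ψ₂ F)) :
    IsCoprime (RingHom.ker Ψ₁) (RingHom.ker Ψ₂) := by
  obtain ⟨N, hN⟩ := isNilpotent_of_not_isUnit h₁
  obtain ⟨y, hy⟩ := (h₂.pow N).exists_right_inv
  obtain ⟨G, rfl⟩ := hsurj y
  rw [Ideal.isCoprime_iff_exists]
  refine ⟨F ^ N * G, ?_, 1 - F ^ N * G, ?_, by ring⟩
  · rw [RingHom.mem_ker, map_mul, map_pow, hN, zero_mul]
  · rw [RingHom.mem_ker, map_sub, map_one, map_mul, map_pow, hy, sub_self]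

theorem pi_surjective_of_separating {ι : Type} [Fintype ι] {T : ι → Type}
    [∀ i, CommRing (T i)] [∀ i, Algebra ℂ (T i)] [∀ i, IsLocalRing (T i)]
    [∀ i, Module.Finite ℂ (T i)] {Ψ : ∀ i, S →ₐ[ℂ] T i} (hΨ : ∀ i, Function.Surjective (Ψ i))
    (hsep : ∀ i j, i ≠ j → ∃ F : S, ¬ IsUnit (Ψ i F) ∧ IsUnit (Ψ j F)) :
    Function.Surjective (AlgHom.pi Ψ) := by
  intro y
  choose x hx using fun i => hΨ i (y i)
  have hcop : Pairwise (Function.onFun IsCoprime fun i => RingHom.ker (Ψ i)) := by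
    intro i j hij
    obtain ⟨F, hFi, hFj⟩ := hsep i j hij
    exact isCoprime_ker_of_separating (hΨ j) hFi hFj
  obtain ⟨r, hr⟩ := Ideal.exists_forall_sub_mem_ideal hcop x
  refine ⟨r, funext fun i => ?_⟩
  have h1 : Ψ i (r - x i) = 0 := hr i
  rw [map_sub, sub_eq_zero, hx] at h1
  exact h1

theorem pi_eq_zero_iff {ι : Type} {T : ι → Type} [∀ i, CommRing (T i)]
    [∀ i, Algebra ℂ (T i)] {Ψ : ∀ i, S →ₐ[ℂ] T i} {F : S} :
    AlgHom.pi Ψ F = 0 ↔ ∀ i, Ψ i F = 0 := funext_iff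

theorem pi_eq_one {ι : Type} {T : ι → Type} [∀ i, CommRing (T i)]
    [∀ i, Algebra ℂ (T i)] {Ψ : ∀ i, S →ₐ[ℂ] T i} {F : S} (h : ∀ i, Ψ i F = 1) :
    AlgHom.pi Ψ F = 1 := funext h

/-- If local algebras are generated by fractions of germs of forms, vanish on the Jacobian ideal
and are separated by forms, then their dimensions are bounded by the Hilbert function of the
Jacobian algebra. -/
theorem sum_finrank_le_jacobianHilbert {f : S} {d : ℕ} (hd : d ≠ 0) (hf : f.IsHomogeneous d)
    (hred : Squarefree f) {ι : Type} [Fintype ι] {T : ι → Type} [∀ i, CommRing (T i)]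
    [∀ i, Algebra ℂ (T i)] [∀ i, IsLocalRing (T i)] {τ : ∀ i, S →ₐ[ℂ] T i}
    (hτ : ∀ i, ∀ F ∈ jacobianIdeal f, τ i F = 0) (hone : ∀ i, ∃ j, τ i (X j) = 1)
    (hfrac : ∀ i x, ∃ F G, IsUnit (τ i G) ∧ x * τ i G = τ i F)
    (hl1 : l.IsHomogeneous 1) (hl : ∀ i, IsUnit (τ i l))
    (hsep : ∀ i j, i ≠ j → ∃ F : S, F.IsHomogeneous 1 ∧ ¬ IsUnit (τ i F) ∧ IsUnit (τ j F)) :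
    (∀ i, Module.Finite ℂ (T i)) ∧ ∃ k₀, ∀ k, k₀ ≤ k →
      ((∑ i, Module.finrank ℂ (T i) : ℕ) : ℚ) ≤ jacobianHilbert f k ∧
      ((∀ F : S, F.IsHomogeneous k → (∀ i, τ i F = 0) → F ∈ jacobianIdeal f) →
        ((∑ i, Module.finrank ℂ (T i) : ℕ) : ℚ) = jacobianHilbert f k) := by
  have hsurj : ∀ i, Function.Surjective (normalizedMap (τ i) l) ∧ Module.Finite ℂ (T i) := by
    intro i
    obtain ⟨j, hj⟩ := hone i
    exact normalizedMap_surjective hd hf hred (hτ i) hj (hfrac i) (hl i) hl1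
  have hfin : ∀ i, Module.Finite ℂ (T i) := fun i => (hsurj i).2
  refine ⟨hfin, ?_⟩
  obtain ⟨Ψ, hΨ⟩ : ∃ Ψ, Ψ = AlgHom.pi fun i => normalizedMap (τ i) l := ⟨_, rfl⟩
  have hzero : ∀ k, ∀ F : S, F.IsHomogeneous k → (Ψ F = 0 ↔ ∀ i, τ i F = 0) := by
    intro k F hF
    rw [hΨ, pi_eq_zero_iff]
    exact forall_congr' fun i => normalizedMap_eq_zero_iff (hl i) hF
  have hrange : LinearMap.range Ψ.toLinearMap = ⊤ := by
    rw [LinearMap.range_eq_top, hΨ]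
    refine pi_surjective_of_separating (fun i => (hsurj i).1) fun i j hij => ?_
    obtain ⟨F, hF, hFi, hFj⟩ := hsep i j hij
    exact ⟨F, mt (isUnit_normalizedMap_iff (hl i) hF).mp hFi,
      (isUnit_normalizedMap_iff (hl j) hF).mpr hFj⟩
  have hone : Ψ l = 1 := by
    rw [hΨ]
    exact pi_eq_one fun i => normalizedMap_self (hl i) hl1
  have hΨJ : ∀ k, ∀ F : S, F.IsHomogeneous k → F ∈ jacobianIdeal f → Ψ F = 0 :=
    fun k F hF hFJ => (hzero k F hF).mpr fun i => hτ i F hFJ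
  obtain ⟨k₀, hk₀⟩ := map_homogeneousSubmodule_eq_range hd hf hred (Ψ := Ψ) hl1 hone hΨJ
  have hdim : ∀ k, k₀ ≤ k →
      Module.finrank ℂ ((homogeneousSubmodule (Fin 3) ℂ k).map Ψ.toLinearMap) =
        ∑ i, Module.finrank ℂ (T i) := by
    intro k hk
    rw [hk₀ k hk, hrange, finrank_top, Module.finrank_pi_fintype]
  refine ⟨k₀, fun k hk => ⟨?_, fun h => ?_⟩⟩
  · rw [← hdim k hk]
    exact finrank_map_homogeneousSubmodule_le (hΨJ k)
  · rw [← hdim k hk]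
    exact finrank_map_homogeneousSubmodule_eq fun F hF =>
      ⟨hΨJ k F hF, fun h0 => h F hF ((hzero k F hF).mp h0)⟩

end Normalization

/-! ### The local rings -/

theorem tjurinaIdeal_ne_top {f : S} {d : ℕ} (hd : d ≠ 0) (hf : f.IsHomogeneous d) {p : Plane}
    (hp : p ∈ singularPoints f) : tjurinaIdeal f p ≠ ⊤ := by
  intro h
  have h1 : tjurinaMap f p 1 = 0 := by
    rw [map_one]
    have := (Ideal.eq_top_iff_one _).mp h
    exact Ideal.Quotient.eq_zero_iff_mem.mpr this
  obtain ⟨s, hs, hmem⟩ := (tjurinaMap_eq_zero_iff hd hf p 1).mp h1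
  rw [map_one, mul_one] at hmem
  have hle : Ideal.span (Set.range fun j => dehomogenize (chart p) (pderiv j f)) ≤
      RingHom.ker (eval (affinePoint p)) := by
    rw [Ideal.span_le]
    rintro _ ⟨j, rfl⟩
    have h2 := hp.2 j
    rw [eval_rep_of_isHomogeneous hf.pderiv] at h2
    exact (mul_eq_zero.mp h2).resolve_left (pow_ne_zero _ (chart_spec p))
  exact hs (hle hmem)

theorem isUnit_tjurinaMap_iff {f : S} {d : ℕ} (hd : d ≠ 0) (hf : f.IsHomogeneous d) {p : Plane}
    (hp : p ∈ singularPoints f) {F : S} {k : ℕ} (hF : F.IsHomogeneous k) :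
    IsUnit (tjurinaMap f p F) ↔ eval p.rep F ≠ 0 := by
  have : Nontrivial (TjurinaAlgebra f p) :=
    Ideal.Quotient.nontrivial_iff.mpr (tjurinaIdeal_ne_top hd hf hp)
  have : IsLocalHom (Ideal.Quotient.mk (tjurinaIdeal f p)) :=
    IsLocalHom.of_surjective _ Ideal.Quotient.mk_surjective
  rw [eval_rep_of_isHomogeneous hF, mul_ne_zero_iff_left (pow_ne_zero _ (chart_spec p))]
  change IsUnit (Ideal.Quotient.mk (tjurinaIdeal f p)
    (algebraMap _ (LocalRingAt p) (dehomogenize (chart p) F))) ↔ _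
  rw [isUnit_map_iff, IsLocalization.AtPrime.isUnit_to_map_iff (LocalRingAt p) (pointIdeal p)]
  rfl

theorem exists_tjurinaMap_mul_eq (f : S) (p : Plane) (x : TjurinaAlgebra f p) :
    ∃ F G, IsUnit (tjurinaMap f p G) ∧ x * tjurinaMap f p G = tjurinaMap f p F := by
  obtain ⟨z, rfl⟩ := Ideal.Quotient.mk_surjective x
  obtain ⟨⟨a, s⟩, hz⟩ := IsLocalization.surj (pointIdeal p).primeCompl z
  obtain ⟨F, -, hF⟩ := exists_isHomogeneous_dehomogenize_eq (chart p) a le_rfl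
  obtain ⟨G, -, hG⟩ := exists_isHomogeneous_dehomogenize_eq (chart p)
    (s : MvPolynomial (Fin 2) ℂ) le_rfl
  have hmap : ∀ H, tjurinaMap f p H = Ideal.Quotient.mk (tjurinaIdeal f p)
      (algebraMap _ (LocalRingAt p) (dehomogenize (chart p) H)) := fun _ => rfl
  refine ⟨F, G, ?_, ?_⟩
  · rw [hmap, hG]
    exact (IsLocalization.map_units (LocalRingAt p) s).map _
  · rw [hmap, hmap, hF, hG, ← map_mul, hz]

/-! ### Several points -/

theorem exists_linear_form {ι : Type*} [Finite ι] (P : ι → Plane) :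
    ∃ l : S, l.IsHomogeneous 1 ∧ ∀ i, eval (P i).rep l ≠ 0 := by
  let E : ι → Subspace ℂ (Fin 3 → ℂ) := fun i =>
    LinearMap.ker (Fintype.linearCombination ℂ (P i).rep)
  have hE : ∀ i, E i ≠ ⊤ := by
    intro i hi
    have : Pi.single (chart (P i)) 1 ∈ E i := hi ▸ Submodule.mem_top
    rw [LinearMap.mem_ker, Fintype.linearCombination_apply_single, one_smul] at this
    exact chart_spec (P i) this
  have hne : ⋃ i, (E i : Set (Fin 3 → ℂ)) ≠ Set.univ := by
    intro h
    obtain ⟨i, hi⟩ := Subspace.exists_eq_top_of_iUnion_eq_univ h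
    exact hE i hi
  obtain ⟨c, hc⟩ := (Set.ne_univ_iff_exists_notMem _).mp hne
  refine ⟨∑ j, C (c j) * X j, IsHomogeneous.sum _ _ _ fun j _ => isHomogeneous_C_mul_X _ _,
    fun i h => hc (Set.mem_iUnion.mpr ⟨i, ?_⟩)⟩
  change Fintype.linearCombination ℂ (P i).rep c = 0
  simpa [Fintype.linearCombination_apply] using h

theorem exists_linear_form_separating {p q : Plane} (hpq : p ≠ q) :
    ∃ l : S, l.IsHomogeneous 1 ∧ eval p.rep l = 0 ∧ eval q.rep l ≠ 0 := by
  obtain ⟨j, hj⟩ : ∃ j, p.rep (chart p) * q.rep j - p.rep j * q.rep (chart p) ≠ 0 := by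
    by_contra! h
    have h1 : (q.rep (chart p) / p.rep (chart p)) • p.rep = q.rep := by
      funext j
      have := h j
      have hc := chart_spec p
      rw [Pi.smul_apply, smul_eq_mul, div_mul_eq_mul_div, div_eq_iff hc]
      linear_combination -this
    have h2 : Projectivization.mk ℂ q.rep q.rep_nonzero =
        Projectivization.mk ℂ p.rep p.rep_nonzero :=
      (Projectivization.mk_eq_mk_iff' ℂ _ _ _ _).mpr ⟨_, h1⟩
    rw [Projectivization.mk_rep, Projectivization.mk_rep] at h2
    exact hpq h2.symm
  refine ⟨C (p.rep (chart p)) * X j - C (p.rep j) * X (chart p),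
    (isHomogeneous_C_mul_X _ _).sub (isHomogeneous_C_mul_X _ _), ?_, ?_⟩
  · simp
    ring
  · simpa using hj

theorem isLocalRing_tjurinaAlgebra {f : S} {d : ℕ} (hd : d ≠ 0) (hf : f.IsHomogeneous d)
    {p : Plane} (hp : p ∈ singularPoints f) : IsLocalRing (TjurinaAlgebra f p) := by
  have : Nontrivial (TjurinaAlgebra f p) :=
    Ideal.Quotient.nontrivial_iff.mpr (tjurinaIdeal_ne_top hd hf hp)
  exact IsLocalRing.of_surjective' (Ideal.Quotient.mk (tjurinaIdeal f p))
    Ideal.Quotient.mk_surjective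

/-- Stated for an arbitrary finite family of distinct singular points, so that it can be used to
prove that there are only finitely many. Equality needs the family to detect membership in the
Jacobian ideal. -/
theorem sum_localTjurina {f : S} {d : ℕ} (hd : d ≠ 0) (hf : f.IsHomogeneous d)
    (hred : Squarefree f) {ι : Type} [Fintype ι] {P : ι → Plane} (hP : Function.Injective P)
    (hsing : ∀ i, P i ∈ singularPoints f) :
    (∀ i, Module.Finite ℂ (TjurinaAlgebra f (P i))) ∧ ∃ k₀, ∀ k, k₀ ≤ k →
      ((∑ i, localTjurina f (P i) : ℕ) : ℚ) ≤ jacobianHilbert f k ∧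
      ((∀ F : S, F.IsHomogeneous k → (∀ i, tjurinaMap f (P i) F = 0) → F ∈ jacobianIdeal f) →
        ((∑ i, localTjurina f (P i) : ℕ) : ℚ) = jacobianHilbert f k) := by
  obtain ⟨l, hl1, hl⟩ := exists_linear_form P
  have hloc : ∀ i, IsLocalRing (TjurinaAlgebra f (P i)) :=
    fun i => isLocalRing_tjurinaAlgebra hd hf (hsing i)
  refine sum_finrank_le_jacobianHilbert hd hf hred (T := fun i => TjurinaAlgebra f (P i))
    (τ := fun i => tjurinaMap f (P i)) (fun i F hF => tjurinaMap_eq_zero_of_mem hd hf _ hF)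
    (fun i => ⟨chart (P i), by simp [tjurinaMap]⟩)
    (fun i x => exists_tjurinaMap_mul_eq f (P i) x) hl1
    (fun i => (isUnit_tjurinaMap_iff hd hf (hsing i) hl1).mpr (hl i)) fun i j hij => ?_
  obtain ⟨F, hF, hFi, hFj⟩ := exists_linear_form_separating (hP.ne hij)
  exact ⟨F, hF, fun h => (isUnit_tjurinaMap_iff hd hf (hsing i) hF).mp h hFi,
    (isUnit_tjurinaMap_iff hd hf (hsing j) hF).mpr hFj⟩

theorem finite_singularPoints {f : S} {d : ℕ} (hd : d ≠ 0) (hf : f.IsHomogeneous d)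
    (hred : Squarefree f) : (singularPoints f).Finite := by
  by_contra hinf
  -- Each singular point contributes at least `1` to a sum bounded by `(d - 1) ^ 2`, so one point
  -- more is a contradiction.
  obtain ⟨s, hs, hcard⟩ := Set.Infinite.exists_subset_card_eq hinf ((d - 1) ^ 2 + 1)
  let e : Fin s.card ≃ s := s.equivFin.symm
  let P : Fin s.card → Plane := fun i => e i
  have hP : Function.Injective P := Subtype.val_injective.comp e.injective
  have hsing : ∀ i, P i ∈ singularPoints f := fun i => hs (e i).2
  obtain ⟨hfin, k₀, hk₀⟩ := sum_localTjurina hd hf hred hP hsing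
  have h1 := (hk₀ (k₀ + 2 * (d - 1)) (by omega)).1
  have h2 := choose_le_finrank_degreePart_jacobian hd hf hred
    (k := k₀ + 2 * (d - 1)) (by omega)
  have h3 : ∀ i, 1 ≤ localTjurina f (P i) := by
    intro i
    have := hfin i
    have : Nontrivial (TjurinaAlgebra f (P i)) :=
      Ideal.Quotient.nontrivial_iff.mpr (tjurinaIdeal_ne_top hd hf (hsing i))
    exact Module.finrank_pos
  have h4 : s.card ≤ ∑ i, localTjurina f (P i) := by
    calc s.card = ∑ _i : Fin s.card, 1 := by simp
      _ ≤ _ := Finset.sum_le_sum fun i _ => h3 i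
  rw [jacobianHilbert] at h1
  have h5 : (((k₀ + 2 * (d - 1) + 2).choose 2 : ℕ) : ℚ) ≤ (Module.finrank ℂ
      (degreePart (fun _ => 0) (k₀ + 2 * (d - 1)) (jacobian f)) : ℚ) + ((d - 1) ^ 2 : ℕ) := by
    exact_mod_cast h2
  have h6 : ((∑ i, localTjurina f (P i) : ℕ) : ℚ) ≤ ((d - 1) ^ 2 : ℕ) := by linarith
  have h7 : ∑ i, localTjurina f (P i) ≤ (d - 1) ^ 2 := by exact_mod_cast h6
  omega

theorem finite_tjurinaAlgebra {f : S} {d : ℕ} (hd : d ≠ 0) (hf : f.IsHomogeneous d)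
    (hred : Squarefree f) {p : Plane} (hp : p ∈ singularPoints f) :
    Module.Finite ℂ (TjurinaAlgebra f p) :=
  (sum_localTjurina hd hf hred (P := fun _ : Unit => p) (fun _ _ _ => rfl) fun _ => hp).1 ()

/-- The total Tjurina number is the dimension of the Jacobian algebra in large degrees. -/
theorem exists_totalTjurina_eq {f : S} {d : ℕ} (hd : d ≠ 0) (hf : f.IsHomogeneous d)
    (hred : Squarefree f) :
    ∃ k₀, ∀ k, k₀ ≤ k → (totalTjurina f : ℚ) = jacobianHilbert f k := by
  have hfinite := finite_singularPoints hd hf hred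
  let s := hfinite.toFinset
  let e : Fin s.card ≃ s := s.equivFin.symm
  let P : Fin s.card → Plane := fun i => e i
  have hP : Function.Injective P := Subtype.val_injective.comp e.injective
  have hsing : ∀ i, P i ∈ singularPoints f := fun i => hfinite.mem_toFinset.mp (e i).2
  have hall : ∀ p ∈ singularPoints f, ∃ i, P i = p := fun p hp =>
    ⟨e.symm ⟨p, hfinite.mem_toFinset.mpr hp⟩, by simp [P]⟩
  obtain ⟨-, k₀, hk₀⟩ := sum_localTjurina hd hf hred hP hsing
  obtain ⟨k₁, hk₁⟩ := exists_forall_mem_jacobianIdeal hd hf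
  refine ⟨max k₀ k₁, fun k hk => ?_⟩
  rw [← (hk₀ k ((le_max_left _ _).trans hk)).2 fun F hF h =>
    hk₁ k ((le_max_right _ _).trans hk) F hF fun p hp => by
      obtain ⟨i, rfl⟩ := hall p hp
      exact h i]
  rw [totalTjurina, finsum_mem_eq_finite_toFinset_sum _ hfinite, ← Finset.sum_coe_sort,
    ← e.sum_comp]

/-! ### The combinatorics of the exponents -/

theorem sum_Icc_one_eq_sum_fin {M : Type*} [AddCommMonoid M] (g : ℕ → M) (n : ℕ) :
    ∑ j ∈ Finset.Icc 1 n, g j = ∑ j : Fin n, g (j + 1) := by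
  rw [← Finset.Ico_add_one_right_eq_Icc, Finset.sum_Ico_eq_sum_range, Nat.add_sub_cancel,
    Finset.sum_range]
  exact Finset.sum_congr rfl fun j _ => by rw [add_comm]

theorem sum_Icc_three_eq_sum_fin {M : Type*} [AddCommMonoid M] (g : ℕ → M) (n : ℕ) :
    ∑ i ∈ Finset.Icc 3 (n + 2), g i = ∑ j : Fin n, g (j + 3) := by
  rw [← Finset.Ico_add_one_right_eq_Icc, Finset.sum_Ico_eq_sum_range,
    show n + 2 + 1 - 3 = n by omega, Finset.sum_range]
  exact Finset.sum_congr rfl fun j _ => by rw [add_comm]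

theorem sum_sum_Ioc_mul (g : ℕ → ℚ) (m : ℕ) :
    ∑ i ∈ Finset.Icc 3 m, ∑ j ∈ Finset.Ioc i m, g i * g j =
      ((∑ i ∈ Finset.Icc 3 m, g i) ^ 2 - ∑ i ∈ Finset.Icc 3 m, g i ^ 2) / 2 := by
  induction m with
  | zero => simp
  | succ m ih =>
    by_cases hm : 3 ≤ m + 1
    · have h1 : ∀ i ∈ Finset.Icc 3 m, ∑ j ∈ Finset.Ioc i (m + 1), g i * g j =
          ∑ j ∈ Finset.Ioc i m, g i * g j + g i * g (m + 1) := fun i hi =>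
        Finset.sum_Ioc_succ_top (Finset.mem_Icc.mp hi).2 _
      rw [Finset.sum_Icc_succ_top hm, Finset.sum_Icc_succ_top hm, Finset.sum_Icc_succ_top hm,
        Finset.sum_congr rfl h1, Finset.sum_add_distrib, ih, ← Finset.sum_mul, Finset.Ioc_self,
        Finset.sum_empty]
      ring
    · rw [Finset.Icc_eq_empty hm]
      simp

namespace MinimalResolution

variable {f : S} {d n : ℕ} (F : MinimalResolution f d (n + 2) n)

theorem exponent_one : F.exponent 1 = F.e 0 := by
  rw [exponent, dif_pos (by omega)]
  rfl

theorem exponent_two : F.exponent 2 = F.e 1 := by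
  rw [exponent, dif_pos (by omega)]
  rfl

theorem exponent_add_three (j : Fin n) : F.exponent (j + 3) = F.e j.succ.succ := by
  have := j.2
  rw [exponent, dif_pos (by omega)]
  rfl

theorem c_eq (hd : d ≠ 0) (j : Fin n) :
    (F.c j : ℤ) = (d - 1 + F.e j.succ.succ : ℕ) + F.eps (j + 1) := by
  have h1 : F.lastDegree (j + 1) = F.c j := by
    have := j.2
    rw [lastDegree, dif_pos (by omega)]
    rfl
  rw [eps, h1, show (j : ℕ) + 1 + 2 = j + 3 by omega, exponent_add_three]
  omega

theorem one_le_eps (hd : d ≠ 0) (j : Fin n) : 1 ≤ F.eps (j + 1) := by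
  have h1 := F.lt_c j (by have := j.2; omega)
  have h2 := F.c_eq hd j
  change d - 1 + F.e j.succ.succ < F.c j at h1
  omega

theorem cast_c_eq (hd : d ≠ 0) (j : Fin n) :
    (F.c j : ℚ) = ((d - 1 + F.e j.succ.succ : ℕ) : ℚ) + F.eps (j + 1) := by
  exact_mod_cast F.c_eq hd j

theorem cast_type (hd : d ≠ 0) : (F.type : ℚ) = F.e 0 + F.e 1 - (d - 1 : ℕ) := by
  rw [type, exponent_one, exponent_two, Nat.cast_sub (by omega)]
  push_cast
  ring

theorem sum_eps_eq (hd : d ≠ 0)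
    (h : ∑ i, ((d - 1 + F.e i : ℕ) : ℚ) = ∑ j, (F.c j : ℚ) + 3 * (d - 1 : ℕ)) :
    ∑ j : Fin n, (F.eps (j + 1) : ℚ) = F.type := by
  rw [F.cast_type hd]
  rw [Fin.sum_univ_succ, Fin.sum_univ_succ, Finset.sum_congr rfl fun j _ => F.cast_c_eq hd j,
    Finset.sum_add_distrib] at h
  push_cast [Fin.succ_zero_eq_one] at h ⊢
  linarith

/-- Expanding $c_j^2$ around $d-1+d_{j+2}$ cancels the squares belonging to $d_3,\dots,d_m$. The
cross term $2(d-1)\sum\epsilon_j$ becomes $2(d-1)t$, and $d-1=d_1+d_2-t$ is eliminated. -/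
theorem sum_sq_eq (hd : d ≠ 0)
    (h : ∑ i, ((d - 1 + F.e i : ℕ) : ℚ) = ∑ j, (F.c j : ℚ) + 3 * (d - 1 : ℕ)) :
    (∑ i, ((d - 1 + F.e i : ℕ) : ℚ) ^ 2 - ∑ j, (F.c j : ℚ) ^ 2 - 3 * (d - 1 : ℕ) ^ 2) / 2 =
      (F.e 0 : ℚ) ^ 2 + F.e 0 * F.e 1 + F.e 1 ^ 2 - F.type * (F.e 0 + F.e 1)
        - ∑ j : Fin n, (F.eps (j + 1) : ℚ) * F.e j.succ.succ
        + ((F.type : ℚ) ^ 2 - ∑ j : Fin n, (F.eps (j + 1) : ℚ) ^ 2) / 2 := by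
  have hs := F.sum_eps_eq hd h
  have ht := F.cast_type hd
  have hsq : ∑ j, (F.c j : ℚ) ^ 2 = ∑ j : Fin n, ((d - 1 + F.e j.succ.succ : ℕ) : ℚ) ^ 2 +
      2 * (d - 1 : ℕ) * ∑ j : Fin n, (F.eps (j + 1) : ℚ) +
      2 * ∑ j : Fin n, (F.eps (j + 1) : ℚ) * F.e j.succ.succ +
      ∑ j : Fin n, (F.eps (j + 1) : ℚ) ^ 2 := by
    rw [Finset.mul_sum, Finset.mul_sum, ← Finset.sum_add_distrib, ← Finset.sum_add_distrib,
      ← Finset.sum_add_distrib]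
    refine Finset.sum_congr rfl fun j _ => ?_
    rw [F.cast_c_eq hd j]
    push_cast
    ring
  rw [hsq, hs, Fin.sum_univ_succ, Fin.sum_univ_succ, ht, Fin.succ_zero_eq_one]
  push_cast
  ring

end MinimalResolution

end PlaneCurve

end

/-! ### Assembly of the main theorem. -/

theorem theorem3p1 (f : PlaneCurve.S) (d : ℕ) (hd : 3 ≤ d) (hf : f.IsHomogeneous d)
    (hred : Squarefree f) (m n : ℕ) (F : PlaneCurve.MinimalResolution f d m n)
    (t : ℤ) (ht : t = F.type) (ht1 : 1 ≤ t) :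
    -- the total Tjurina number is a finite sum of finite dimensions
    ((PlaneCurve.singularPoints f).Finite ∧
      ∀ p ∈ PlaneCurve.singularPoints f, Module.Finite ℂ (PlaneCurve.TjurinaAlgebra f p)) ∧
    -- the resolution ends with `n = m - 2 ≥ 1` free summands
    (3 ≤ m ∧ n = m - 2 ∧ LinearIndependent PlaneCurve.S F.syz₂) ∧
    -- the `ε_j` form an ordered partition of `t`
    ((∀ j ∈ Finset.Icc 1 n, 1 ≤ F.eps j) ∧ ∑ j ∈ Finset.Icc 1 n, F.eps j = t) ∧
    -- the formula
    ∃ R : ℚ,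
      R = ((t : ℚ) ^ 2 - ∑ i ∈ Finset.Icc 3 m, (F.eps (i - 2) : ℚ) ^ 2) / 2 ∧
      (PlaneCurve.totalTjurina f : ℚ) =
        (F.exponent 1 : ℚ) ^ 2 + (F.exponent 1 : ℚ) * F.exponent 2 + (F.exponent 2 : ℚ) ^ 2
          - t * ((F.exponent 1 : ℚ) + F.exponent 2)
          - ∑ i ∈ Finset.Icc 3 m, (F.eps (i - 2) : ℚ) * F.exponent i + R ∧
      R = ∑ i ∈ Finset.Icc 3 m, ∑ j ∈ Finset.Ioc i m,
        (F.eps (i - 2) : ℚ) * (F.eps (j - 2) : ℚ) ∧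
      0 ≤ R ∧
      (R = 0 ↔ m = 3) := by
  have hd0 : d ≠ 0 := by omega
  obtain ⟨rfl, hsum, K, hK⟩ := F.numerical_relations hd0 hf hred
  obtain ⟨K', hK'⟩ := PlaneCurve.exists_totalTjurina_eq hd0 hf hred
  have hτ : (PlaneCurve.totalTjurina f : ℚ) = _ :=
    (hK' (K + K') (by omega)).trans (hK (K + K') (by omega))
  rw [F.sum_sq_eq hd0 hsum] at hτ
  have hQ := F.sum_eps_eq hd0 hsum
  have hZ : ∑ j : Fin n, F.eps (j + 1) = F.type := by exact_mod_cast hQ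
  subst ht
  -- With no relations the sum of the $\epsilon_j$ is empty, contradicting $t\ge1$.
  have hn : n ≠ 0 := by
    rintro rfl
    rw [Finset.univ_eq_empty, Finset.sum_empty] at hZ
    omega
  have hpos : ∀ j ∈ Finset.Icc 1 n, 1 ≤ F.eps j := by
    intro j hj
    rw [Finset.mem_Icc] at hj
    have := F.one_le_eps hd0 ⟨j - 1, by omega⟩
    simpa [Nat.sub_add_cancel hj.1] using this
  have hpos' : ∀ i ∈ Finset.Icc 3 (n + 2), (0 : ℚ) < F.eps (i - 2) := by
    intro i hi
    rw [Finset.mem_Icc] at hi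
    have := hpos (i - 2) (Finset.mem_Icc.mpr (by omega))
    exact_mod_cast (by omega : 0 < F.eps (i - 2))
  have hprod : ∀ i ∈ Finset.Icc 3 (n + 2), ∀ j ∈ Finset.Ioc i (n + 2),
      (0 : ℚ) < F.eps (i - 2) * F.eps (j - 2) := by
    intro i hi j hj
    refine mul_pos (hpos' i hi) (hpos' j ?_)
    rw [Finset.mem_Icc] at hi ⊢
    rw [Finset.mem_Ioc] at hj
    omega
  have hsq : ∑ i ∈ Finset.Icc 3 (n + 2), (F.eps (i - 2) : ℚ) ^ 2 =
      ∑ j : Fin n, (F.eps (j + 1) : ℚ) ^ 2 :=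
    PlaneCurve.sum_Icc_three_eq_sum_fin (fun i => (F.eps (i - 2) : ℚ) ^ 2) n
  have hlin : ∑ i ∈ Finset.Icc 3 (n + 2), (F.eps (i - 2) : ℚ) = F.type := by
    rw [← hQ]
    exact PlaneCurve.sum_Icc_three_eq_sum_fin (fun i => (F.eps (i - 2) : ℚ)) n
  have hmix : ∑ i ∈ Finset.Icc 3 (n + 2), (F.eps (i - 2) : ℚ) * F.exponent i =
      ∑ j : Fin n, (F.eps (j + 1) : ℚ) * F.e j.succ.succ := by
    rw [PlaneCurve.sum_Icc_three_eq_sum_fin (fun i => (F.eps (i - 2) : ℚ) * F.exponent i) n]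
    exact Finset.sum_congr rfl fun j _ => by rw [F.exponent_add_three]; rfl
  have hR : ((F.type : ℚ) ^ 2 - ∑ i ∈ Finset.Icc 3 (n + 2), (F.eps (i - 2) : ℚ) ^ 2) / 2 =
      ∑ i ∈ Finset.Icc 3 (n + 2), ∑ j ∈ Finset.Ioc i (n + 2),
        (F.eps (i - 2) : ℚ) * (F.eps (j - 2) : ℚ) := by
    rw [PlaneCurve.sum_sum_Ioc_mul (fun i => (F.eps (i - 2) : ℚ)), hlin]
  have hnonneg : ∀ i ∈ Finset.Icc 3 (n + 2), 0 ≤ ∑ j ∈ Finset.Ioc i (n + 2),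
      (F.eps (i - 2) : ℚ) * (F.eps (j - 2) : ℚ) :=
    fun i hi => Finset.sum_nonneg fun j hj => (hprod i hi j hj).le
  refine ⟨⟨PlaneCurve.finite_singularPoints hd0 hf hred,
    fun p hp => PlaneCurve.finite_tjurinaAlgebra hd0 hf hred hp⟩,
    ⟨by omega, by omega, F.linearIndependent_syz₂⟩,
    ⟨hpos, (PlaneCurve.sum_Icc_one_eq_sum_fin F.eps n).trans hZ⟩, _, rfl, ?_, hR, ?_, ?_⟩
  · rw [hτ, hmix, hsq, F.exponent_one, F.exponent_two]
  · rw [hR]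
    exact Finset.sum_nonneg hnonneg
  · rw [hR, Finset.sum_eq_zero_iff_of_nonneg hnonneg]
    constructor
    · intro h
      by_contra hm
      -- If `m ≥ 4`, the product $\epsilon_1\epsilon_2$ occurs in `R` and is positive.
      have h3 : 3 ∈ Finset.Icc 3 (n + 2) := Finset.mem_Icc.mpr (by omega)
      have h4 : 4 ∈ Finset.Ioc 3 (n + 2) := Finset.mem_Ioc.mpr (by omega)
      have h5 := (Finset.sum_eq_zero_iff_of_nonneg
        fun j hj => (hprod 3 h3 j hj).le).mp (h 3 h3) 4 h4
      exact (hprod 3 h3 4 h4).ne' h5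
    · intro hm i hi
      rw [Finset.mem_Icc] at hi
      rw [Finset.Ioc_eq_empty (by omega), Finset.sum_empty]
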